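/- **Setting.** Let $\Pi$ be a simply connected cell complex consisting of elementary squares of $\mathbb Z^2$; its vertices split into the even ones $G$ ($m+n$ even) and the odd ones $G^*$ ($m+n$ odd). Two vertices of $G$ are *neighboring* ($v\sim w$) if they are opposite corners of a square of $\Pi$; we assume that any two vertices of $G$ are joined by a chain of neighboring ones. A vertex $v\in G$ is *internal* if all four squares around it belong to $\Pi$. A *hyperbolic ring* is a pair of concentric circles $(C,c)$ in the hyperbolic plane with outer radius $R\in(0,\infty)$ and signed inner radius $r\in(-R,R]$ (positive: counter-clockwise, negative: clockwise orientation; a ring with $|r|=R$ is positively oriented; for $r=0$ the inner circle is a point). A circle of signed radius $r$ with center $k$ has at its point $p$ the unit normal $u$ if $k=\exp_p(ru)$. Rings with given radii $(r_v,R_v)_{v\in G}$ *form a generalized orthogonal ring pattern* if one can choose their centers and points $\ell_x$, $x\in G^*$, in the hyperbolic plane such that (1) for neighboring $v,w$ the outer circle $C_v$ intersects the inner circle $c_w$ orthogonally, and vice versa; (2) for every $x\in G^*$ the inner circles of the left and right vertices $x\mp(1,0)$ and the outer circles of the lower and upper vertices $x\mp(0,1)$ (as far as they are joined to $x$ by an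 edge of $\Pi$) all pass through $\ell_x$, and there is a unit tangent vector $u$ at $\ell_x$ such that these circles have at $\ell_x$ the normals $u,-u$ (left, right inner circle) and $Ju,-Ju$ (lower, upper outer circle), where $J$ is the rotation by $+\pi/2$. (So the two inner circles touch, from outside if their signed radii have the same sign and from inside otherwise, and the two outer circles touch from outside.) No condition is imposed on how often the touching points wind around a ring. For $0<q\le1$ let $\mathrm{sn},\mathrm{cn},\mathrm{dn}$ be the Jacobi elliptic functions of modulus $q$ with quarter periods $K,K'$ (for $q=1$: $\mathrm{sn}=\tanh$, $\mathrm{cn}=\mathrm{dn}=1/\cosh$, $K=\infty$, $K'=\pi/2$). **Theorem.** Rings with radii $(r_v,R_v)_{v\in G}$ form a generalized orthogonal ring pattern in the hyperbolic plane if and only if there are $q\in(0,1]$ and $\gamma_v\in[0,2K]$ ($v\in G$) such that, with $\beta_v=\gamma_v+iK'$, $$\cosh R_v=\mathrm{sn}\,\beta_v,\qquad \sinh R_v=i\,\mathrm{cn}\,\beta_v,\qquad \sinh r_v=i\,\mathrm{dn}\,\beta_v\qquad(v\in G)$$ and for every internal vertex $v\in G$ $$\prod_{w\sim v}\frac{\mathrm{sn}\frac{\beta_v-\beta_w+iK'}{2}}{\mathrm{sn}\frac{\beta_v+\beta_w+iK'}{2}}=1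 .$$ (As the radii are finite, such $\gamma_v$ are neither $0$ nor $2K$.) Equivalently, there are $q\in(0,1]$ and $\gamma_v\in[0,2K]$ such that $$\cosh R_v=\frac1{q\,\mathrm{sn}\,\gamma_v},\qquad \tanh R_v=\mathrm{dn}\,\gamma_v,\qquad \sinh r_v=\frac{\mathrm{cn}\,\gamma_v}{\mathrm{sn}\,\gamma_v}\qquad(v\in G)$$ and for every internal vertex $v\in G$ $$\prod_{w\sim v}\frac{\mathrm{sn}\frac{\gamma_v-\gamma_w+iK'}{2}}{\mathrm{sn}\frac{\gamma_v+\gamma_w-iK'}{2}}=1 .$$ Moreover, for every $q\in(0,1]$ and all $\gamma_v\in[0,2K]$ ($v\in G$), the two product equations are equivalent at each internal vertex. -/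

import Mathlib

noncomputable section

namespace RingPattern

open UpperHalfPlane

/-! ## Jacobi elliptic functions of modulus `q`, `0 < q ≤ 1` -/

/-- The incomplete elliptic integral of the first kind with modulus `q`. -/
def ellF (q φ : ℝ) : ℝ := ∫ t in (0 : ℝ)..φ, 1 / Real.sqrt (1 - q ^ 2 * Real.sin t ^ 2)

/-- The complementary modulus. -/
def compl (q : ℝ) : ℝ := Real.sqrt (1 - q ^ 2)

/-- The quarter period `K`, for a modulus `q < 1` (for `q = 1` the quarter period is infinite,
and this definition is never used then). -/
def quarterK (q : ℝ) : ℝ := ellF q (Real.pi / 2)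

/-- The imaginary quarter period `K'`, for a modulus `0 < q ≤ 1`. -/
def quarterK' (q : ℝ) : ℝ := quarterK (compl q)

/-- The Jacobi amplitude on the real line, for a modulus `0 ≤ q ≤ 1`: the inverse function of
`ellF q : ℝ → ℝ` if `q < 1`, and the Gudermannian function if `q = 1`. -/
def am (q u : ℝ) : ℝ :=
  if q < 1 then Function.invFun (ellF q) u else Real.arcsin (Real.tanh u)

def snR (q u : ℝ) : ℝ := Real.sin (am q u)

def cnR (q u : ℝ) : ℝ := Real.cos (am q u)

def dnR (q u : ℝ) : ℝ := Real.sqrt (1 - q ^ 2 * snR q u ^ 2)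

/-- The common denominator of the complex functions `sn`, `cn`, `dn` at `x + i y`; it vanishes
exactly at the poles. -/
def jacobiDen (q : ℝ) (z : ℂ) : ℝ :=
  cnR (compl q) z.im ^ 2 + q ^ 2 * snR q z.re ^ 2 * snR (compl q) z.im ^ 2

/-- The Jacobi function `sn (z, q)` of a complex argument, split into real functions of the real
part of `z` (modulus `q`) and of the imaginary part of `z` (complementary modulus). -/
def sn (q : ℝ) (z : ℂ) : ℂ :=
  (snR q z.re * dnR (compl q) z.im
    + Complex.I * (cnR q z.re * dnR q z.re * snR (compl q) z.im * cnR (compl q) z.im))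
    / jacobiDen q z

/-- The Jacobi function `cn (z, q)` of a complex argument. -/
def cn (q : ℝ) (z : ℂ) : ℂ :=
  (cnR q z.re * cnR (compl q) z.im
    - Complex.I * (snR q z.re * dnR q z.re * snR (compl q) z.im * dnR (compl q) z.im))
    / jacobiDen q z

/-- The Jacobi function `dn (z, q)` of a complex argument. -/
def dn (q : ℝ) (z : ℂ) : ℂ :=
  (dnR q z.re * cnR (compl q) z.im * dnR (compl q) z.im
    - Complex.I * (q ^ 2 * snR q z.re * cnR q z.re * snR (compl q) z.im))
    / jacobiDen q z

/-! ## Square grid complexes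

A complex is given by the set `S` of its elementary squares; the square
`[a, a + 1] × [b, b + 1]` is named by its lower left corner `(a, b)`. -/

/-- `x` is one of the four corners of the square `s`. -/
def IsCorner (x s : ℤ × ℤ) : Prop :=
  (x.1 = s.1 ∨ x.1 = s.1 + 1) ∧ (x.2 = s.2 ∨ x.2 = s.2 + 1)

/-- The even vertices `G` of the complex: they carry the rings. -/
def ringVertices (S : Set (ℤ × ℤ)) : Set (ℤ × ℤ) :=
  {x | (∃ s ∈ S, IsCorner x s) ∧ Even (x.1 + x.2)}

/-- The odd vertices `G*` of the complex: they carry the touching points. -/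
def pointVertices (S : Set (ℤ × ℤ)) : Set (ℤ × ℤ) :=
  {x | (∃ s ∈ S, IsCorner x s) ∧ Odd (x.1 + x.2)}

/-- `x` and `y` are the end points of a side of the square `s`. -/
def IsSide (s x y : ℤ × ℤ) : Prop :=
  IsCorner x s ∧ IsCorner y s ∧ |x.1 - y.1| + |x.2 - y.2| = 1

/-- `x` and `y` are joined by an edge of the complex. -/
def Edge (S : Set (ℤ × ℤ)) (x y : ℤ × ℤ) : Prop := ∃ s ∈ S, IsSide s x y

/-- Elementary homotopies of edge paths (written as lists of vertices): removing a backtracking,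
or pushing two consecutive sides of a square across that square. -/
inductive ElemHomotopy (S : Set (ℤ × ℤ)) : List (ℤ × ℤ) → List (ℤ × ℤ) → Prop
  | backtrack (l l' : List (ℤ × ℤ)) (x y : ℤ × ℤ) (h : Edge S x y) :
      ElemHomotopy S (l ++ [x, y, x] ++ l') (l ++ [x] ++ l')
  | square (l l' : List (ℤ × ℤ)) (s x y z w : ℤ × ℤ) (hs : s ∈ S)
      (hxy : IsSide s x y) (hyz : IsSide s y z) (hzw : IsSide s z w) (hwx : IsSide s w x)
      (hxz : x ≠ z) (hyw : y ≠ w) :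
      ElemHomotopy S (l ++ [x, y, z] ++ l') (l ++ [x, w, z] ++ l')

/-- The complex is connected, and its edge path group is trivial: every closed edge path
`x, …, x` is homotopic to the constant path. -/
def IsSimplyConnected (S : Set (ℤ × ℤ)) : Prop :=
  (∀ x y, (∃ s ∈ S, IsCorner x s) → (∃ s ∈ S, IsCorner y s) →
    Relation.ReflTransGen (Edge S) x y) ∧
  ∀ (x : ℤ × ℤ) (l : List (ℤ × ℤ)), List.IsChain (Edge S) (x :: (l ++ [x])) →
    Relation.EqvGen (ElemHomotopy S) (x :: (l ++ [x])) [x]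

/-- `v` and `w` are neighboring even vertices: opposite corners of a square of the complex. -/
def Neighbors (S : Set (ℤ × ℤ)) (v w : ℤ × ℤ) : Prop :=
  v ≠ w ∧ Even (v.1 + v.2) ∧ Even (w.1 + w.2) ∧ ∃ s ∈ S, IsCorner v s ∧ IsCorner w s

/-- Any two even vertices are joined by a chain of neighboring even vertices. -/
def RingsConnected (S : Set (ℤ × ℤ)) : Prop :=
  ∀ v ∈ ringVertices S, ∀ w ∈ ringVertices S, Relation.ReflTransGen (Neighbors S) v w

/-- `v` is an internal even vertex: all four squares around it belong to the complex. -/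
def IsInternal (S : Set (ℤ × ℤ)) (v : ℤ × ℤ) : Prop :=
  Even (v.1 + v.2) ∧ (v.1, v.2) ∈ S ∧ (v.1 - 1, v.2) ∈ S ∧ (v.1, v.2 - 1) ∈ S ∧
    (v.1 - 1, v.2 - 1) ∈ S

/-- The offsets from an internal even vertex to its four neighbors. -/
def diagonals : Finset (ℤ × ℤ) := ({1, -1} : Finset ℤ) ×ˢ ({1, -1} : Finset ℤ)

/-! ## Rings in the hyperbolic plane `ℍ` -/

/-- The conformal, orientation preserving isometry from `ℍ` to the unit disk that sends `p`
to `0`. Geodesics through `p` become diameters, and a point at distance `d` from `p` goes to a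
point of modulus `tanh (d / 2)`. Directions at `p` are measured by unit complex numbers in this
disk. -/
def toDisk (p z : ℍ) : ℂ := ((z : ℂ) - (p : ℂ)) / ((z : ℂ) - (starRingEnd ℂ) (p : ℂ))

/-- The circle with center `k` and signed radius `r` passes through `p` and has the unit normal
`u` there: the center is reached from `p` by going the signed distance `r` along the geodesic
with direction `u`. So `u` points to the center if `r > 0` and away from it if `r < 0`; for
`r = 0` the circle is the point `p = k`, and every unit vector is a normal. -/
def HasNormal (k : ℍ) (r : ℝ) (p : ℍ) (u : ℂ) : Prop :=
  dist p k = |r| ∧ ‖u‖ = 1 ∧ toDisk p k = (Real.tanh (r / 2) : ℂ) * u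

/-- Two circles intersect orthogonally: they have a common point with perpendicular normals. -/
def MeetOrthogonally (k₁ : ℍ) (r₁ : ℝ) (k₂ : ℍ) (r₂ : ℝ) : Prop :=
  ∃ (p : ℍ) (u w : ℂ), HasNormal k₁ r₁ p u ∧ HasNormal k₂ r₂ p w ∧
    (u * (starRingEnd ℂ) w).re = 0

/-- `r` and `R` are the signed inner radius and the outer radius of a ring; an annulus of width
zero (`|r| = R`) is positively oriented. -/
def IsRing (r R : ℝ) : Prop := 0 < R ∧ -R < r ∧ r ≤ R

/-- The rings with centers `k v`, signed inner radii `r v` and outer radii `R v` (`v` an even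
vertex) and the points `ℓ x` (`x` an odd vertex) form a generalized orthogonal ring pattern.

The field `touch` says that, at `ℓ x`, the inner circles of the left and the right ring adjacent
to `x` have opposite normals `u`, `-u`, so that they touch (from outside if the radii have the
same sign, from inside if they have different signs), the outer circles of the lower and the
upper ring adjacent to `x` touch from outside, with normals `i u`, `-i u`, and the direction
`i u` to the lower ring is obtained from the direction `u` by a counter-clockwise rotation by a
right angle. Only adjacencies that are edges of the complex count. Nothing is required of the
number of times that the touching points of a ring wind around it. -/
structure IsGeneralizedPattern (S : Set (ℤ × ℤ)) (r R : ℤ × ℤ → ℝ) (k ℓ : ℤ × ℤ → ℍ) :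
    Prop where
  orthogonal : ∀ v w, Neighbors S v w → MeetOrthogonally (k v) (R v) (k w) (r w)
  touch : ∀ x ∈ pointVertices S, ∃ u : ℂ, ‖u‖ = 1 ∧
    (∀ v, v = (x.1 - 1, x.2) → Edge S x v → HasNormal (k v) (r v) (ℓ x) u) ∧
    (∀ v, v = (x.1 + 1, x.2) → Edge S x v → HasNormal (k v) (r v) (ℓ x) (-u)) ∧
    (∀ v, v = (x.1, x.2 - 1) → Edge S x v → HasNormal (k v) (R v) (ℓ x) (Complex.I * u)) ∧
    (∀ v, v = (x.1, x.2 + 1) → Edge S x v → HasNormal (k v) (R v) (ℓ x) (-(Complex.I * u)))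

/-- Rings with the prescribed radii can be placed in the hyperbolic plane so that they form a
generalized orthogonal ring pattern. -/
def FormGeneralizedPattern (S : Set (ℤ × ℤ)) (r R : ℤ × ℤ → ℝ) : Prop :=
  ∃ k ℓ : ℤ × ℤ → ℍ, IsGeneralizedPattern S r R k ℓ

/-! ## Uniformizing variables and the governing equations -/

/-- `γ` lies in `[0, 2K]`, which is `[0, ∞)` for `q = 1`. -/
def InInterval (q γ : ℝ) : Prop := 0 ≤ γ ∧ (q < 1 → γ ≤ 2 * quarterK q)

/-- The variable `β = γ + i K'`. -/
def betaOf (q γ : ℝ) : ℂ := (γ : ℂ) + Complex.I * (quarterK' q : ℂ)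

/-- The ring with radii `r`, `R` is given by the variable `β`, with modulus `q`. -/
def UniformizedByBeta (q : ℝ) (β : ℂ) (r R : ℝ) : Prop :=
  (Real.cosh R : ℂ) = sn q β ∧ (Real.sinh R : ℂ) = Complex.I * cn q β ∧
    (Real.sinh r : ℂ) = Complex.I * dn q β

/-- The ring with radii `r`, `R` is given by the real variable `γ`, with modulus `q`. -/
def UniformizedByGamma (q γ r R : ℝ) : Prop :=
  Real.cosh R = 1 / (q * snR q γ) ∧ Real.tanh R = dnR q γ ∧ Real.sinh r = cnR q γ / snR q γ

/-- The product equation at `v` in the variables `β`. -/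
def BetaEquation (q : ℝ) (β : ℤ × ℤ → ℂ) (v : ℤ × ℤ) : Prop :=
  ∏ d ∈ diagonals,
    sn q ((β v - β (v + d) + Complex.I * (quarterK' q : ℂ)) / 2) /
      sn q ((β v + β (v + d) + Complex.I * (quarterK' q : ℂ)) / 2) = 1

/-- The product equation at `v` in the variables `γ`. -/
def GammaEquation (q : ℝ) (γ : ℤ × ℤ → ℝ) (v : ℤ × ℤ) : Prop :=
  ∏ d ∈ diagonals,
    sn q (((γ v : ℂ) - (γ (v + d) : ℂ) + Complex.I * (quarterK' q : ℂ)) / 2) /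
      sn q (((γ v : ℂ) + (γ (v + d) : ℂ) - Complex.I * (quarterK' q : ℂ)) / 2) = 1

end RingPattern

end

noncomputable section

namespace RingPattern

open UpperHalfPlane

/-! ## The elliptic integral and the amplitude -/

section Amplitude

variable {q : ℝ}

/-! The centers of neighboring rings and a common touching point form a right triangle whose legs
are an outer and an inner radius. By the hyperbolic theorem of Pythagoras, `cosh R_v * cosh r_w` and
`cosh R_w * cosh r_v` are both the hyperbolic cosine of the distance between the centers. So `cosh r
/ cosh R` is constant along chains of neighbors. This constant is the modulus `q`, and it is at most
1 because `|r| ≤ R` (`FormGeneralizedPattern.exists_modulus`). The relation `cosh r = q cosh R` is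
uniformized by `sn γ = 1 / cosh r`, `cn γ = tanh r`, `dn γ = tanh R` (`exists_uniformizedByGamma`).

What remains is closure around internal vertices. Two neighboring centers and their two common
touching points form a kite with right angles at the touching points. The radii determine its angle
at a center, a unit complex number `kiteAngle` (`kite_closed`), and the four angles around an
internal vertex have product 1. In the variables `γ` this angle is minus the inverse of one factor
of the product equation (`kiteAngle_mul_gammaFactor`). Four signs cancel, so closure and the product
equation are the same statement (`gammaEquation_iff`). Since only unit complex numbers are compared,
winding numbers play no role.

Conversely, suppose that the angles close up. Each edge of the complex then carries a permutation of
the set of frames (points with a unit direction): turn, move by the signed radius, turn.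
`kite_close` shows that these permutations are compatible around every square. On a simply connected
complex they therefore integrate to a choice of frames (`exists_developing`), whose base points are
the centers and the touching points.

The elliptic identity `phase_mul_gammaFactor` rests on the addition theorem, proved from the
differential equations of `sn`, `cn`, `dn`. It is applied on the line of imaginary part `K' / 2`,
where `sn` has constant modulus. -/

lemma one_sub_sq_mul_sin_sq_pos (h0 : 0 ≤ q) (h1 : q < 1) (t : ℝ) :
    0 < 1 - q ^ 2 * Real.sin t ^ 2 := by
  have h2 : q ^ 2 < 1 := by nlinarith
  nlinarith [Real.sin_sq_le_one t, sq_nonneg (Real.sin t), sq_nonneg q]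

lemma continuous_ellF_integrand (h0 : 0 ≤ q) (h1 : q < 1) :
    Continuous fun t : ℝ => 1 / Real.sqrt (1 - q ^ 2 * Real.sin t ^ 2) := by
  refine continuous_const.div (by fun_prop) fun t => ?_
  exact (Real.sqrt_pos.2 (one_sub_sq_mul_sin_sq_pos h0 h1 t)).ne'

lemma hasDerivAt_ellF (h0 : 0 ≤ q) (h1 : q < 1) (φ : ℝ) :
    HasDerivAt (ellF q) (1 / Real.sqrt (1 - q ^ 2 * Real.sin φ ^ 2)) φ :=
  ((continuous_ellF_integrand h0 h1).integral_hasStrictDerivAt 0 φ).hasDerivAt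

lemma strictMono_ellF (h0 : 0 ≤ q) (h1 : q < 1) : StrictMono (ellF q) :=
  strictMono_of_hasDerivAt_pos (hasDerivAt_ellF h0 h1) fun t =>
    one_div_pos.2 (Real.sqrt_pos.2 (one_sub_sq_mul_sin_sq_pos h0 h1 t))

lemma continuous_ellF (h0 : 0 ≤ q) (h1 : q < 1) : Continuous (ellF q) :=
  continuous_iff_continuousAt.2 fun t => (hasDerivAt_ellF h0 h1 t).continuousAt

lemma ellF_zero : ellF q 0 = 0 := by simp [ellF]

lemma ellF_add_pi (h0 : 0 ≤ q) (h1 : q < 1) (φ : ℝ) :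
    ellF q (φ + Real.pi) = ellF q φ + ellF q Real.pi := by
  have hp : Function.Periodic (fun t : ℝ => 1 / Real.sqrt (1 - q ^ 2 * Real.sin t ^ 2))
      Real.pi := fun t => by simp [Real.sin_add_pi]
  have hi := fun a b => (continuous_ellF_integrand h0 h1).intervalIntegrable (μ :=
    MeasureTheory.volume) a b
  have h := hp.intervalIntegral_add_eq φ 0
  rw [zero_add] at h
  rw [ellF, ellF, ellF, ← h, intervalIntegral.integral_add_adjacent_intervals (hi _ _) (hi _ _)]

lemma ellF_neg (φ : ℝ) : ellF q (-φ) = -ellF q φ := by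
  rw [ellF, ellF, intervalIntegral.integral_symm, neg_inj]
  have := intervalIntegral.integral_comp_neg (a := -φ) (b := 0)
    fun t : ℝ => 1 / Real.sqrt (1 - q ^ 2 * Real.sin t ^ 2)
  simpa using this

lemma ellF_pi (h0 : 0 ≤ q) (h1 : q < 1) : ellF q Real.pi = 2 * quarterK q := by
  have h := ellF_add_pi h0 h1 (-(Real.pi / 2))
  rw [ellF_neg, show -(Real.pi / 2) + Real.pi = Real.pi / 2 by ring] at h
  rw [quarterK]
  linarith

/-- The integrand is at least 1. With oddness, this makes `ellF q` unbounded in both directions and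
hence surjective. -/
lemma le_ellF (h0 : 0 ≤ q) (h1 : q < 1) {φ : ℝ} (hφ : 0 ≤ φ) : φ ≤ ellF q φ := by
  have h := intervalIntegral.integral_mono_on (μ := MeasureTheory.volume) hφ
    (f := fun _ => (1 : ℝ)) (g := fun t : ℝ => 1 / Real.sqrt (1 - q ^ 2 * Real.sin t ^ 2))
    (continuous_const.intervalIntegrable _ _)
    ((continuous_ellF_integrand h0 h1).intervalIntegrable _ _) fun t _ => ?_
  · simpa [ellF] using h
  · have hpos := one_sub_sq_mul_sin_sq_pos h0 h1 t
    rw [le_div_iff₀ (Real.sqrt_pos.2 hpos), one_mul, Real.sqrt_le_iff]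
    refine ⟨zero_le_one, ?_⟩
    nlinarith [mul_nonneg (sq_nonneg q) (sq_nonneg (Real.sin t))]

lemma surjective_ellF (h0 : 0 ≤ q) (h1 : q < 1) : Function.Surjective (ellF q) := by
  refine (continuous_ellF h0 h1).surjective ?_ ?_
  · refine Filter.tendsto_atTop_mono' _ ?_ Filter.tendsto_id
    filter_upwards [Filter.eventually_ge_atTop 0] with φ hφ using le_ellF h0 h1 hφ
  · refine Filter.tendsto_atBot_mono' _ ?_ Filter.tendsto_id
    filter_upwards [Filter.eventually_le_atBot 0] with φ hφ
    have := le_ellF h0 h1 (neg_nonneg.2 hφ)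
    rw [ellF_neg] at this
    simp only [id]
    linarith

lemma ellF_am (h0 : 0 ≤ q) (h1 : q < 1) (u : ℝ) : ellF q (am q u) = u := by
  rw [am, if_pos h1]
  exact Function.rightInverse_invFun (surjective_ellF h0 h1) u

lemma am_ellF (h0 : 0 ≤ q) (h1 : q < 1) (φ : ℝ) : am q (ellF q φ) = φ := by
  rw [am, if_pos h1]
  exact Function.leftInverse_invFun (strictMono_ellF h0 h1).injective φ

lemma continuous_am (h0 : 0 ≤ q) (h1 : q < 1) : Continuous (am q) := by
  have h := ((strictMono_ellF h0 h1).orderIsoOfSurjective _ (surjective_ellF h0 h1)).symm.continuous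
  convert h using 1
  ext u
  apply (strictMono_ellF h0 h1).injective
  rw [ellF_am h0 h1]
  exact ((StrictMono.orderIsoOfSurjective_self_symm_apply _ _ _ _)).symm

lemma snR_one (u : ℝ) : snR 1 u = Real.tanh u := by
  rw [snR, am, if_neg (lt_irrefl _),
    Real.sin_arcsin (Real.neg_one_lt_tanh u).le (Real.tanh_lt_one u).le]

lemma one_sub_sq_mul_snR_sq_pos (h0 : 0 ≤ q) (h1 : q ≤ 1) (u : ℝ) :
    0 < 1 - q ^ 2 * snR q u ^ 2 := by
  rcases h1.lt_or_eq with h1 | rfl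
  · exact one_sub_sq_mul_sin_sq_pos h0 h1 _
  · rw [snR_one]
    linarith [Real.tanh_sq_lt_one u]

lemma hasDerivAt_tanh (u : ℝ) : HasDerivAt Real.tanh (1 - Real.tanh u ^ 2) u := by
  have h := (Real.hasDerivAt_sinh u).div (Real.hasDerivAt_cosh u) (Real.cosh_pos u).ne'
  have he : Real.sinh / Real.cosh = Real.tanh := by
    ext x; exact (Real.tanh_eq_sinh_div_cosh x).symm
  rw [he] at h
  refine h.congr_deriv ?_
  rw [Real.tanh_eq_sinh_div_cosh]
  field_simp [(Real.cosh_pos u).ne']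

/-- For `q < 1` this is the derivative of an inverse function, for `q = 1` the chain rule. From here
on both cases satisfy the same differential equations, so the addition theorem includes `q = 1`. -/
lemma hasDerivAt_am (h0 : 0 ≤ q) (h1 : q ≤ 1) (u : ℝ) : HasDerivAt (am q) (dnR q u) u := by
  rcases h1.lt_or_eq with h1 | rfl
  · have h := HasDerivAt.of_local_left_inverse (continuous_am h0 h1).continuousAt
      (hasDerivAt_ellF h0 h1 (am q u)) (one_div_pos.2 (Real.sqrt_pos.2
        (one_sub_sq_mul_sin_sq_pos h0 h1 _))).ne'
      (Filter.Eventually.of_forall (ellF_am h0 h1))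
    simpa [dnR, snR] using h
  · have h := (Real.hasDerivAt_arcsin (Real.neg_one_lt_tanh u).ne' (Real.tanh_lt_one u).ne).comp u
      (hasDerivAt_tanh u)
    have he : am 1 = Real.arcsin ∘ Real.tanh := by ext x; simp [am]
    rw [he]
    refine h.congr_deriv ?_
    have hp : 0 < 1 - Real.tanh u ^ 2 := by linarith [Real.tanh_sq_lt_one u]
    rw [dnR, snR_one, one_pow, one_mul, one_div_mul_eq_div, Real.div_sqrt]

lemma am_zero (h0 : 0 ≤ q) (h1 : q ≤ 1) : am q 0 = 0 := by
  rcases h1.lt_or_eq with h1 | rfl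
  · simpa [ellF_zero] using am_ellF h0 h1 0
  · simp [am]

lemma am_neg (h0 : 0 ≤ q) (h1 : q ≤ 1) (u : ℝ) : am q (-u) = -am q u := by
  rcases h1.lt_or_eq with h1 | rfl
  swap
  · simp [am]
  apply (strictMono_ellF h0 h1).injective
  rw [ellF_neg, ellF_am h0 h1, ellF_am h0 h1]

lemma am_add_two_quarterK (h0 : 0 ≤ q) (h1 : q < 1) (u : ℝ) :
    am q (u + 2 * quarterK q) = am q u + Real.pi := by
  apply (strictMono_ellF h0 h1).injective
  rw [ellF_am h0 h1, ellF_add_pi h0 h1, ellF_am h0 h1, ellF_pi h0 h1]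

lemma am_quarterK (h0 : 0 ≤ q) (h1 : q < 1) : am q (quarterK q) = Real.pi / 2 :=
  am_ellF h0 h1 _

end Amplitude

/-! ## Real Jacobi functions -/

section RealJacobi

variable {q : ℝ}

lemma snR_sq_add_cnR_sq (q u : ℝ) : snR q u ^ 2 + cnR q u ^ 2 = 1 := Real.sin_sq_add_cos_sq _

lemma dnR_pos (h0 : 0 ≤ q) (h1 : q ≤ 1) (u : ℝ) : 0 < dnR q u :=
  Real.sqrt_pos.2 (one_sub_sq_mul_snR_sq_pos h0 h1 u)

lemma dnR_sq (h0 : 0 ≤ q) (h1 : q ≤ 1) (u : ℝ) : dnR q u ^ 2 = 1 - q ^ 2 * snR q u ^ 2 :=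
  Real.sq_sqrt (one_sub_sq_mul_snR_sq_pos h0 h1 u).le

lemma hasDerivAt_snR (h0 : 0 ≤ q) (h1 : q ≤ 1) (u : ℝ) :
    HasDerivAt (snR q) (cnR q u * dnR q u) u :=
  (Real.hasDerivAt_sin _).comp u (hasDerivAt_am h0 h1 u)

lemma hasDerivAt_cnR (h0 : 0 ≤ q) (h1 : q ≤ 1) (u : ℝ) :
    HasDerivAt (cnR q) (-(snR q u * dnR q u)) u := by
  have h := (Real.hasDerivAt_cos _).comp u (hasDerivAt_am h0 h1 u)
  rwa [neg_mul] at h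

lemma hasDerivAt_dnR (h0 : 0 ≤ q) (h1 : q ≤ 1) (u : ℝ) :
    HasDerivAt (dnR q) (-(q ^ 2 * snR q u * cnR q u)) u := by
  have h := ((((hasDerivAt_snR h0 h1 u).pow 2).const_mul (q ^ 2)).const_sub 1).sqrt
    (one_sub_sq_mul_snR_sq_pos h0 h1 u).ne'
  have hd := (dnR_pos h0 h1 u).ne'
  refine h.congr_deriv ?_
  change _ / (2 * dnR q u) = _
  field_simp
  simp
  ring

lemma snR_zero (h0 : 0 ≤ q) (h1 : q ≤ 1) : snR q 0 = 0 := by simp [snR, am_zero h0 h1]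

lemma cnR_zero (h0 : 0 ≤ q) (h1 : q ≤ 1) : cnR q 0 = 1 := by simp [cnR, am_zero h0 h1]

lemma dnR_zero (h0 : 0 ≤ q) (h1 : q ≤ 1) : dnR q 0 = 1 := by simp [dnR, snR_zero h0 h1]

lemma snR_neg (h0 : 0 ≤ q) (h1 : q ≤ 1) (u : ℝ) : snR q (-u) = -snR q u := by
  simp [snR, am_neg h0 h1]

lemma cnR_neg (h0 : 0 ≤ q) (h1 : q ≤ 1) (u : ℝ) : cnR q (-u) = cnR q u := by
  simp [cnR, am_neg h0 h1]

lemma dnR_neg (h0 : 0 ≤ q) (h1 : q ≤ 1) (u : ℝ) : dnR q (-u) = dnR q u := by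
  simp [dnR, snR_neg h0 h1]

lemma snR_sq_le_one (q u : ℝ) : snR q u ^ 2 ≤ 1 := Real.sin_sq_le_one _

end RealJacobi

/-! ## The addition theorem -/

/-- A solution `(f, g, h)` on the real line of the differential equations of `(sn, cn, dn)`, with
parameter `m`. -/
structure IsJacobiTriple (m : ℂ) (f g h : ℝ → ℂ) : Prop where
  deriv_f : ∀ t, HasDerivAt f (g t * h t) t
  deriv_g : ∀ t, HasDerivAt g (-(f t * h t)) t
  deriv_h : ∀ t, HasDerivAt h (-(m * f t * g t)) t
  g_sq : ∀ t, g t ^ 2 = 1 - f t ^ 2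
  h_sq : ∀ t, h t ^ 2 = 1 - m * f t ^ 2

/-- The quotient rule gives derivative 0. The addition theorem follows from this: its right-hand
side, evaluated at `(x + y - t, t)`, does not depend on `t`, and `t = 0` and `t = y` give its two
sides. -/
lemma div_eq_of_hasDerivAt {N D N' D' : ℝ → ℂ} (hN : ∀ t, HasDerivAt N (N' t) t)
    (hD : ∀ t, HasDerivAt D (D' t) t) (h0 : ∀ t, D t ≠ 0) (h : ∀ t, N' t * D t = N t * D' t)
    (a b : ℝ) : N a / D a = N b / D b := by
  have hd : ∀ t, HasDerivAt (fun t => N t / D t) 0 t := fun t => by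
    have := (hN t).div (hD t) (h0 t)
    rwa [h t, sub_self, zero_div] at this
  exact is_const_of_deriv_eq_zero (fun t => (hd t).differentiableAt) (fun t => (hd t).deriv) a b

namespace IsJacobiTriple

variable {m : ℂ} {f g h s c d : ℝ → ℂ}

section

variable (F : IsJacobiTriple m f g h) (E : IsJacobiTriple m s c d)
  (hs : s 0 = 0) (hc : c 0 = 1) (hd : d 0 = 1) (hΔ : ∀ x y, 1 - m * f x ^ 2 * s y ^ 2 ≠ 0)

include F

lemma deriv_f_sub (T t : ℝ) : HasDerivAt (fun t => f (T - t)) (-(g (T - t) * h (T - t))) t :=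
  HasDerivAt.comp_const_sub T t (F.deriv_f (T - t))

lemma deriv_g_sub (T t : ℝ) : HasDerivAt (fun t => g (T - t)) (f (T - t) * h (T - t)) t := by
  have := HasDerivAt.comp_const_sub T t (F.deriv_g (T - t))
  rwa [neg_neg] at this

lemma deriv_h_sub (T t : ℝ) :
    HasDerivAt (fun t => h (T - t)) (m * f (T - t) * g (T - t)) t := by
  have := HasDerivAt.comp_const_sub T t (F.deriv_h (T - t))
  rwa [neg_neg] at this

include E

lemma deriv_denominator (T t : ℝ) : HasDerivAt (fun t => 1 - m * f (T - t) ^ 2 * s t ^ 2)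
    (2 * m * f (T - t) * s t * (g (T - t) * h (T - t) * s t - f (T - t) * c t * d t)) t := by
  refine (((((F.deriv_f_sub T t).pow 2).const_mul m).mul ((E.deriv_f t).pow 2)).const_sub
    1).congr_deriv ?_
  simp
  ring

include hs hc hd hΔ

/-- Only `(s, c, d)` needs the initial values of `(sn, cn, dn)`; `(f, g, h)` may be any solution,
for instance a translate by an imaginary amount. The condition on the derivatives is a polynomial
identity modulo the quadratic relations. -/
lemma f_add (x y : ℝ) : f (x + y) =
    (f x * (c y * d y) + s y * (g x * h x)) / (1 - m * f x ^ 2 * s y ^ 2) := by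
  have := div_eq_of_hasDerivAt
    (fun t => ((F.deriv_f_sub (x + y) t).mul ((E.deriv_g t).mul (E.deriv_h t))).add
      ((E.deriv_f t).mul ((F.deriv_g_sub (x + y) t).mul (F.deriv_h_sub (x + y) t))))
    (deriv_denominator F E (x + y)) (fun t => hΔ _ _) (fun t => by
      have h1 := F.g_sq (x + y - t)
      have h2 := F.h_sq (x + y - t)
      have h3 := E.g_sq t
      have h4 := E.h_sq t
      simp only [Pi.add_apply, Pi.mul_apply]
      grind) 0 y
  simpa [hs, hc, hd] using this

lemma g_add (x y : ℝ) : g (x + y) =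
    (g x * c y - f x * h x * (s y * d y)) / (1 - m * f x ^ 2 * s y ^ 2) := by
  have := div_eq_of_hasDerivAt
    (fun t => ((F.deriv_g_sub (x + y) t).mul (E.deriv_g t)).sub
      (((F.deriv_f_sub (x + y) t).mul (F.deriv_h_sub (x + y) t)).mul
        ((E.deriv_f t).mul (E.deriv_h t))))
    (deriv_denominator F E (x + y)) (fun t => hΔ _ _) (fun t => by
      have h1 := F.g_sq (x + y - t)
      have h2 := F.h_sq (x + y - t)
      have h3 := E.g_sq t
      have h4 := E.h_sq t
      simp only [Pi.sub_apply, Pi.mul_apply]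
      grind) 0 y
  simpa [hs, hc, hd] using this

lemma h_add (x y : ℝ) : h (x + y) =
    (h x * d y - m * (f x * g x) * (s y * c y)) / (1 - m * f x ^ 2 * s y ^ 2) := by
  have := div_eq_of_hasDerivAt
    (fun t => ((F.deriv_h_sub (x + y) t).mul (E.deriv_h t)).sub
      ((((F.deriv_f_sub (x + y) t).mul (F.deriv_g_sub (x + y) t)).const_mul m).mul
        ((E.deriv_f t).mul (E.deriv_g t))))
    (deriv_denominator F E (x + y)) (fun t => hΔ _ _) (fun t => by
      have h1 := F.g_sq (x + y - t)
      have h2 := F.h_sq (x + y - t)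
      have h3 := E.g_sq t
      have h4 := E.h_sq t
      simp only [Pi.sub_apply, Pi.mul_apply]
      grind) 0 y
  simpa [hs, hc, hd] using this

end

end IsJacobiTriple

/-! ### Addition and duplication formulas for the real functions. -/

section Duplication

variable {q : ℝ}

lemma isJacobiTriple_real (h0 : 0 ≤ q) (h1 : q ≤ 1) : IsJacobiTriple ((q : ℂ) ^ 2)
    (fun t => (snR q t : ℂ)) (fun t => (cnR q t : ℂ)) (fun t => (dnR q t : ℂ)) where
  deriv_f t := by simpa using (hasDerivAt_snR h0 h1 t).ofReal_comp
  deriv_g t := by simpa using (hasDerivAt_cnR h0 h1 t).ofReal_comp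
  deriv_h t := by simpa using (hasDerivAt_dnR h0 h1 t).ofReal_comp
  g_sq t := by
    have := snR_sq_add_cnR_sq q t
    have h : cnR q t ^ 2 = 1 - snR q t ^ 2 := by linarith
    exact_mod_cast h
  h_sq t := by exact_mod_cast dnR_sq h0 h1 t

lemma mul_snR_sq_lt_one (h0 : 0 ≤ q) (h1 : q ≤ 1) (u : ℝ) : q * snR q u ^ 2 < 1 := by
  nlinarith [one_sub_sq_mul_snR_sq_pos h0 h1 u, snR_sq_le_one q u, sq_nonneg (snR q u),
    mul_nonneg h0 (sq_nonneg (snR q u)), sq_nonneg (q * snR q u)]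

lemma one_sub_mul_snR_sq_mul_snR_sq_pos (h0 : 0 ≤ q) (h1 : q ≤ 1) (x y : ℝ) :
    0 < 1 - q ^ 2 * snR q x ^ 2 * snR q y ^ 2 := by
  have h2 := mul_snR_sq_lt_one h0 h1 x
  have h3 := mul_snR_sq_lt_one h0 h1 y
  have := mul_nonneg h0 (sq_nonneg (snR q x))
  have := mul_nonneg h0 (sq_nonneg (snR q y))
  nlinarith

lemma duplication_denominator_pos (h0 : 0 ≤ q) (h1 : q ≤ 1) (x : ℝ) :
    0 < 1 - q ^ 2 * snR q x ^ 4 := by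
  have := one_sub_mul_snR_sq_mul_snR_sq_pos h0 h1 x x
  linarith [show q ^ 2 * snR q x ^ 2 * snR q x ^ 2 = q ^ 2 * snR q x ^ 4 by ring]

lemma snR_two_mul (h0 : 0 ≤ q) (h1 : q ≤ 1) (x : ℝ) :
    snR q (2 * x) = 2 * snR q x * cnR q x * dnR q x / (1 - q ^ 2 * snR q x ^ 4) := by
  have F := isJacobiTriple_real h0 h1
  have h := F.f_add F (by simp [snR_zero h0 h1]) (by simp [cnR_zero h0 h1])
    (by simp [dnR_zero h0 h1])
    (fun x y => by exact_mod_cast (one_sub_mul_snR_sq_mul_snR_sq_pos h0 h1 x y).ne') x x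
  rw [two_mul]
  norm_cast at h
  rw [h]
  congr 1 <;> ring

lemma cnR_two_mul (h0 : 0 ≤ q) (h1 : q ≤ 1) (x : ℝ) :
    cnR q (2 * x) = (cnR q x ^ 2 - snR q x ^ 2 * dnR q x ^ 2) / (1 - q ^ 2 * snR q x ^ 4) := by
  have F := isJacobiTriple_real h0 h1
  have h := F.g_add F (by simp [snR_zero h0 h1]) (by simp [cnR_zero h0 h1])
    (by simp [dnR_zero h0 h1])
    (fun x y => by exact_mod_cast (one_sub_mul_snR_sq_mul_snR_sq_pos h0 h1 x y).ne') x x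
  rw [two_mul]
  norm_cast at h
  rw [h]
  congr 1 <;> ring

lemma dnR_two_mul (h0 : 0 ≤ q) (h1 : q ≤ 1) (x : ℝ) : dnR q (2 * x) =
    (dnR q x ^ 2 - q ^ 2 * snR q x ^ 2 * cnR q x ^ 2) / (1 - q ^ 2 * snR q x ^ 4) := by
  have F := isJacobiTriple_real h0 h1
  have h := F.h_add F (by simp [snR_zero h0 h1]) (by simp [cnR_zero h0 h1])
    (by simp [dnR_zero h0 h1])
    (fun x y => by exact_mod_cast (one_sub_mul_snR_sq_mul_snR_sq_pos h0 h1 x y).ne') x x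
  rw [two_mul]
  norm_cast at h
  rw [h]
  congr 1 <;> ring

end Duplication

/-! ## Values at the quarter period and at its half -/

section QuarterPeriod

variable {q : ℝ}

lemma snR_quarterK (h0 : 0 ≤ q) (h1 : q < 1) : snR q (quarterK q) = 1 := by
  simp [snR, am_quarterK h0 h1]

lemma cnR_quarterK (h0 : 0 ≤ q) (h1 : q < 1) : cnR q (quarterK q) = 0 := by
  simp [cnR, am_quarterK h0 h1]

lemma snR_add_two_quarterK (h0 : 0 ≤ q) (h1 : q < 1) (u : ℝ) :
    snR q (u + 2 * quarterK q) = -snR q u := by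
  simp [snR, am_add_two_quarterK h0 h1, Real.sin_add_pi]

lemma cnR_add_two_quarterK (h0 : 0 ≤ q) (h1 : q < 1) (u : ℝ) :
    cnR q (u + 2 * quarterK q) = -cnR q u := by
  simp [cnR, am_add_two_quarterK h0 h1, Real.cos_add_pi]

lemma dnR_add_two_quarterK (h0 : 0 ≤ q) (h1 : q < 1) (u : ℝ) :
    dnR q (u + 2 * quarterK q) = dnR q u := by
  simp [dnR, snR_add_two_quarterK h0 h1]

lemma quarterK_pos (h0 : 0 ≤ q) (h1 : q < 1) : 0 < quarterK q :=
  (by positivity : (0 : ℝ) < Real.pi / 2).trans_le (le_ellF h0 h1 (by positivity))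

lemma am_half_quarterK_mem (h0 : 0 ≤ q) (h1 : q < 1) :
    0 < am q (quarterK q / 2) ∧ am q (quarterK q / 2) < Real.pi / 2 := by
  have hm := strictMono_ellF h0 h1
  have hK := quarterK_pos h0 h1
  constructor
  · apply hm.lt_iff_lt.1
    rw [ellF_am h0 h1, ellF_zero]
    linarith
  · apply hm.lt_iff_lt.1
    rw [ellF_am h0 h1]
    change _ < quarterK q
    linarith

lemma snR_half_quarterK_pos (h0 : 0 ≤ q) (h1 : q < 1) : 0 < snR q (quarterK q / 2) := by
  have h := am_half_quarterK_mem h0 h1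
  exact Real.sin_pos_of_pos_of_lt_pi h.1 (by linarith [Real.pi_pos])

lemma cnR_half_quarterK_pos (h0 : 0 ≤ q) (h1 : q < 1) : 0 < cnR q (quarterK q / 2) := by
  have h := am_half_quarterK_mem h0 h1
  exact Real.cos_pos_of_mem_Ioo ⟨by linarith, h.2⟩

/-- Since `cn K = 0`, the duplication formula for `cn` at `K / 2` is a quadratic equation for `sn²
(K / 2)`, with roots `1 / (1 + p)` and, if `p ≠ 1`, `1 / (1 - p)`. The second exceeds 1. -/
lemma snR_half_quarterK_sq (h0 : 0 ≤ q) (h1 : q < 1) {p : ℝ} (hp : 0 < p)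
    (hpq : p ^ 2 + q ^ 2 = 1) : snR q (quarterK q / 2) ^ 2 * (1 + p) = 1 := by
  set s := snR q (quarterK q / 2)
  have h := cnR_two_mul h0 h1.le (quarterK q / 2)
  have hc := snR_sq_add_cnR_sq q (quarterK q / 2)
  have hd := dnR_sq h0 h1.le (quarterK q / 2)
  have hpos := duplication_denominator_pos h0 h1.le (quarterK q / 2)
  rw [mul_div_cancel₀ _ two_ne_zero, cnR_quarterK h0 h1, eq_comm, div_eq_zero_iff,
    or_iff_left hpos.ne', hd] at h
  have hs := snR_sq_le_one q (quarterK q / 2)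
  have h3 : (s ^ 2 * (1 + p) - 1) * (s ^ 2 * (1 - p) - 1) = 0 := by
    have hq : q ^ 2 = 1 - p ^ 2 := by linarith
    rw [hq] at h
    linear_combination h - hc
  rcases mul_eq_zero.1 h3 with h3 | h3
  · linarith
  · nlinarith [snR_half_quarterK_pos h0 h1, sq_pos_of_pos (snR_half_quarterK_pos h0 h1)]

end QuarterPeriod

/-! ### The complementary modulus: values at `K'` and `K' / 2`. -/

section Complementary

variable {q : ℝ}

lemma compl_nonneg (q : ℝ) : 0 ≤ compl q := Real.sqrt_nonneg _

lemma compl_sq (h0 : 0 < q) (h1 : q ≤ 1) : compl q ^ 2 = 1 - q ^ 2 :=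
  Real.sq_sqrt (by nlinarith)

lemma compl_lt_one (h0 : 0 < q) (h1 : q ≤ 1) : compl q < 1 := by
  nlinarith [compl_sq h0 h1, compl_nonneg q]

lemma snR_compl_half_sq (h0 : 0 < q) (h1 : q ≤ 1) :
    snR (compl q) (quarterK' q / 2) ^ 2 = 1 / (1 + q) := by
  rw [eq_div_iff (by positivity)]
  exact snR_half_quarterK_sq (compl_nonneg q) (compl_lt_one h0 h1) h0
    (by rw [compl_sq h0 h1]; ring)

lemma dnR_compl_half (h0 : 0 < q) (h1 : q ≤ 1) :
    dnR (compl q) (quarterK' q / 2) = Real.sqrt q := by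
  rw [dnR, snR_compl_half_sq h0 h1, compl_sq h0 h1]
  congr 1
  field_simp
  ring

lemma cnR_compl_half (h0 : 0 < q) (h1 : q ≤ 1) : cnR (compl q) (quarterK' q / 2) =
    Real.sqrt q * snR (compl q) (quarterK' q / 2) := by
  have hs := snR_compl_half_sq h0 h1
  have hc := snR_sq_add_cnR_sq (compl q) (quarterK' q / 2)
  have hc0 := cnR_half_quarterK_pos (compl_nonneg q) (compl_lt_one h0 h1)
  have hs0 := snR_half_quarterK_pos (compl_nonneg q) (compl_lt_one h0 h1)
  refine (sq_eq_sq₀ hc0.le (mul_nonneg (Real.sqrt_nonneg _) hs0.le)).1 ?_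
  change cnR (compl q) (quarterK' q / 2) ^ 2 = _
  rw [mul_pow, Real.sq_sqrt h0.le]
  change _ = q * snR (compl q) (quarterK' q / 2) ^ 2
  rw [hs] at hc ⊢
  field_simp at hc ⊢
  linarith

lemma snR_compl_quarterK' (h0 : 0 < q) (h1 : q ≤ 1) : snR (compl q) (quarterK' q) = 1 :=
  snR_quarterK (compl_nonneg q) (compl_lt_one h0 h1)

lemma cnR_compl_quarterK' (h0 : 0 < q) (h1 : q ≤ 1) : cnR (compl q) (quarterK' q) = 0 :=
  cnR_quarterK (compl_nonneg q) (compl_lt_one h0 h1)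

lemma dnR_compl_quarterK' (h0 : 0 < q) (h1 : q ≤ 1) : dnR (compl q) (quarterK' q) = q := by
  rw [dnR, snR_compl_quarterK' h0 h1, compl_sq h0 h1]
  rw [show 1 - (1 - q ^ 2) * 1 ^ 2 = q ^ 2 by ring, Real.sqrt_sq h0.le]

end Complementary

/-! ## The functions on the line of imaginary part `K' / 2` -/

section HalfLine

variable {q : ℝ}

/-- The values of `sn` at the points `t + i K' / 2`. -/
def halfSn (q t : ℝ) : ℂ :=
  ((1 + q) * snR q t + Complex.I * (cnR q t * dnR q t)) / (Real.sqrt q * (1 + q * snR q t ^ 2))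

/-- The values of `cn` at the points `t + i K' / 2`. -/
def halfCn (q t : ℝ) : ℂ :=
  Real.sqrt (1 + q) * (cnR q t - Complex.I * (snR q t * dnR q t)) /
    (Real.sqrt q * (1 + q * snR q t ^ 2))

/-- The values of `dn` at the points `t + i K' / 2`. -/
def halfDn (q t : ℝ) : ℂ :=
  Real.sqrt (1 + q) * (dnR q t - Complex.I * (q * snR q t * cnR q t)) / (1 + q * snR q t ^ 2)

lemma one_add_mul_snR_sq_ne_zero (h0 : 0 < q) (t : ℝ) : (1 : ℂ) + q * (snR q t : ℂ) ^ 2 ≠ 0 := by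
  have : (0 : ℝ) < 1 + q * snR q t ^ 2 := by positivity
  exact_mod_cast this.ne'

lemma sqrt_ne_zero_complex (h0 : 0 < q) : (Real.sqrt q : ℂ) ≠ 0 := by
  exact_mod_cast (Real.sqrt_pos.2 h0).ne'

lemma sqrt_sq_complex (h0 : 0 ≤ q) : (Real.sqrt q : ℂ) ^ 2 = q := by
  exact_mod_cast Real.sq_sqrt h0

/-- Translation by `i K' / 2` preserves the differential equations. They are checked on the closed
formulas, so no complex differentiation of `sn` is needed. -/
lemma isJacobiTriple_half (h0 : 0 < q) (h1 : q ≤ 1) :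
    IsJacobiTriple ((q : ℂ) ^ 2) (halfSn q) (halfCn q) (halfDn q) := by
  have F := isJacobiTriple_real h0.le h1
  have hr := sqrt_ne_zero_complex h0
  have hr2 := sqrt_sq_complex h0.le
  have hp2 := sqrt_sq_complex (add_nonneg zero_le_one h0.le)
  push_cast at hp2
  have hI := Complex.I_sq
  have hden (t : ℝ) : HasDerivAt (fun t => (1 : ℂ) + q * (snR q t : ℂ) ^ 2)
      (2 * q * snR q t * cnR q t * dnR q t) t := by
    refine ((((F.deriv_f t).pow 2).const_mul (q : ℂ)).const_add 1).congr_deriv ?_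
    simp
    ring
  constructor <;> intro t <;> have hn := one_add_mul_snR_sq_ne_zero h0 t <;>
    have hc := F.g_sq t <;> have hd := F.h_sq t
  · have h := (((F.deriv_f t).const_mul (1 + q : ℂ)).add
      (((F.deriv_g t).mul (F.deriv_h t)).const_mul Complex.I)).div
      ((hden t).const_mul (Real.sqrt q : ℂ)) (mul_ne_zero hr hn)
    refine h.congr_deriv ?_
    simp only [halfCn, halfDn, Pi.add_apply, Pi.mul_apply]
    field_simp
    grind
  · have h := (((F.deriv_g t).sub (((F.deriv_f t).mul (F.deriv_h t)).const_mul
      Complex.I)).const_mul (Real.sqrt (1 + q) : ℂ)).div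
      ((hden t).const_mul (Real.sqrt q : ℂ)) (mul_ne_zero hr hn)
    refine h.congr_deriv ?_
    simp only [halfSn, halfDn, Pi.sub_apply, Pi.mul_apply]
    field_simp
    grind
  · have h := (((F.deriv_h t).sub ((((F.deriv_f t).const_mul (q : ℂ)).mul
      (F.deriv_g t)).const_mul Complex.I)).const_mul (Real.sqrt (1 + q) : ℂ)).div (hden t) hn
    refine h.congr_deriv ?_
    simp only [halfSn, halfCn, Pi.sub_apply, Pi.mul_apply]
    field_simp
    grind
  · simp only [halfSn, halfCn]
    field_simp
    grind
  · simp only [halfSn, halfDn]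
    field_simp
    grind

end HalfLine

/-! ### The factors of the product equations. -/

section Factor

variable {q : ℝ}

lemma sn_add_period (h0 : 0 < q) (h1 : q ≤ 1) (z : ℂ) :
    sn q (z + 2 * (Complex.I * quarterK' q)) = sn q z := by
  have hre : (z + 2 * (Complex.I * quarterK' q)).re = z.re := by simp
  have him : (z + 2 * (Complex.I * quarterK' q)).im = z.im + 2 * quarterK (compl q) := by
    simp [quarterK']
  have k0 := compl_nonneg q
  have k1 := compl_lt_one h0 h1
  simp only [sn, jacobiDen, hre, him, snR_add_two_quarterK k0 k1, cnR_add_two_quarterK k0 k1,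
    dnR_add_two_quarterK k0 k1]
  push_cast
  ring_nf

lemma sn_half_upper (h0 : 0 < q) (h1 : q ≤ 1) (t : ℝ) :
    sn q ((t : ℂ) + Complex.I * (quarterK' q / 2)) = halfSn q t := by
  have hre : ((t : ℂ) + Complex.I * (quarterK' q / 2)).re = t := by simp
  have him : ((t : ℂ) + Complex.I * (quarterK' q / 2)).im = quarterK' q / 2 := by simp
  simp only [sn, jacobiDen, hre, him, halfSn, dnR_compl_half h0 h1, cnR_compl_half h0 h1]
  have hs : (snR (compl q) (quarterK' q / 2) : ℂ) ^ 2 * (1 + q) = 1 := by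
    have := snR_compl_half_sq h0 h1
    rw [eq_div_iff (by positivity)] at this
    exact_mod_cast this
  have hq : (q : ℂ) ≠ 0 := by exact_mod_cast h0.ne'
  have hs0 : (snR (compl q) (quarterK' q / 2) : ℂ) ≠ 0 := fun h => by simp [h] at hs
  have hr := sqrt_ne_zero_complex h0
  have hr2 := sqrt_sq_complex h0.le
  have hn := one_add_mul_snR_sq_ne_zero h0 t
  have hI := Complex.I_sq
  push_cast
  rw [div_eq_div_iff _ (mul_ne_zero hr hn)]
  · generalize (snR (compl q) (quarterK' q / 2) : ℂ) = σ at *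
    generalize (Real.sqrt q : ℂ) = r at *
    grind
  · have : ((Real.sqrt q : ℂ) * (snR (compl q) (quarterK' q / 2) : ℂ)) ^ 2 + (q : ℂ) ^ 2 *
        (snR q t : ℂ) ^ 2 * (snR (compl q) (quarterK' q / 2) : ℂ) ^ 2 =
        q * (snR (compl q) (quarterK' q / 2) : ℂ) ^ 2 * (1 + q * (snR q t : ℂ) ^ 2) := by
      rw [mul_pow, hr2]; ring
    rw [this]
    exact mul_ne_zero (mul_ne_zero hq (pow_ne_zero 2 hs0)) hn

lemma sn_conj (h0 : 0 < q) (h1 : q ≤ 1) (z : ℂ) :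
    sn q ((starRingEnd ℂ) z) = (starRingEnd ℂ) (sn q z) := by
  have k0 := compl_nonneg q
  have k1 := (compl_lt_one h0 h1).le
  simp only [sn, jacobiDen, Complex.conj_re, Complex.conj_im, snR_neg k0 k1, cnR_neg k0 k1,
    dnR_neg k0 k1, map_div₀, map_add, map_mul, Complex.conj_ofReal, Complex.conj_I]
  push_cast
  ring_nf

/-- On this line `sn` has constant modulus `1 / √q`. The denominator of a factor of the product
equation is a conjugate of such a value, so this turns the quotient into a product. -/
lemma halfSn_mul_conj (h0 : 0 < q) (h1 : q ≤ 1) (t : ℝ) :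
    q * (halfSn q t * (starRingEnd ℂ) (halfSn q t)) = 1 := by
  have F := isJacobiTriple_real h0.le h1
  have hc := F.g_sq t
  have hd := F.h_sq t
  have hr := sqrt_ne_zero_complex h0
  have hr2 := sqrt_sq_complex h0.le
  have hn := one_add_mul_snR_sq_ne_zero h0 t
  have hI := Complex.I_sq
  simp only [halfSn, map_div₀, map_add, map_mul, map_pow, map_one, Complex.conj_ofReal,
    Complex.conj_I]
  field_simp
  grind

/-- The factor of the product equation that belongs to the variables `γ` and `γ'`. -/
lemma gammaFactor_eq_mul (h0 : 0 < q) (h1 : q ≤ 1) (γ γ' : ℝ) :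
    sn q (((γ : ℂ) - (γ' : ℂ) + Complex.I * (quarterK' q : ℂ)) / 2) /
      sn q (((γ : ℂ) + (γ' : ℂ) - Complex.I * (quarterK' q : ℂ)) / 2) =
    q * (halfSn q (γ / 2 + γ' / 2) * halfSn q (γ / 2 + -(γ' / 2))) := by
  have e1 : ((γ : ℂ) - (γ' : ℂ) + Complex.I * (quarterK' q : ℂ)) / 2 =
      ((γ / 2 + -(γ' / 2) : ℝ) : ℂ) + Complex.I * (quarterK' q / 2) := by
    push_cast; ring
  have e2 : ((γ : ℂ) + (γ' : ℂ) - Complex.I * (quarterK' q : ℂ)) / 2 =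
      (starRingEnd ℂ) (((γ / 2 + γ' / 2 : ℝ) : ℂ) + Complex.I * (quarterK' q / 2)) := by
    simp only [map_add, map_mul, map_div₀, Complex.conj_ofReal, Complex.conj_I, Complex.conj_ofNat]
    push_cast; ring
  have h := halfSn_mul_conj h0 h1 (γ / 2 + γ' / 2)
  rw [e1, e2, sn_conj h0 h1, sn_half_upper h0 h1, sn_half_upper h0 h1, div_eq_iff]
  · linear_combination (-halfSn q (γ / 2 + -(γ' / 2))) * h
  · rintro h2
    rw [h2] at h
    simp at h

/-- The shift `i K'` cancels in the numerators, and the arguments of the denominators differ by the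
period `2 i K'`. -/
lemma betaFactor_eq_gammaFactor (h0 : 0 < q) (h1 : q ≤ 1) (γ γ' : ℝ) :
    sn q ((betaOf q γ - betaOf q γ' + Complex.I * (quarterK' q : ℂ)) / 2) /
      sn q ((betaOf q γ + betaOf q γ' + Complex.I * (quarterK' q : ℂ)) / 2) =
    sn q (((γ : ℂ) - (γ' : ℂ) + Complex.I * (quarterK' q : ℂ)) / 2) /
      sn q (((γ : ℂ) + (γ' : ℂ) - Complex.I * (quarterK' q : ℂ)) / 2) := by
  rw [← sn_add_period h0 h1 (((γ : ℂ) + (γ' : ℂ) - Complex.I * (quarterK' q : ℂ)) / 2)]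
  simp only [betaOf]
  congr 2 <;> ring

lemma halfSn_mul_halfSn (h0 : 0 < q) (h1 : q ≤ 1) (x y : ℝ) :
    halfSn q (x + y) * halfSn q (x + -y) =
      (halfSn q x ^ 2 - (snR q y : ℂ) ^ 2) /
        (1 - (q : ℂ) ^ 2 * halfSn q x ^ 2 * (snR q y : ℂ) ^ 2) ∧
      1 - (q : ℂ) ^ 2 * halfSn q x ^ 2 * (snR q y : ℂ) ^ 2 ≠ 0 := by
  have F := isJacobiTriple_half h0 h1
  have E := isJacobiTriple_real h0.le h1
  -- As `q |halfSn|² = 1`, a zero would force `q sn² y = 1`.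
  have hΔ : ∀ x y, 1 - (q : ℂ) ^ 2 * halfSn q x ^ 2 * (snR q y : ℂ) ^ 2 ≠ 0 := fun x y h => by
    have h2 := congrArg norm (sub_eq_zero.1 h)
    have h3 := halfSn_mul_conj h0 h1 x
    rw [Complex.mul_conj, Complex.normSq_eq_norm_sq] at h3
    have h4 : q * ‖halfSn q x‖ ^ 2 = 1 := by exact_mod_cast h3
    simp only [norm_one, norm_mul, norm_pow, Complex.norm_real, Real.norm_eq_abs, sq_abs] at h2
    have h5 := mul_snR_sq_lt_one h0.le h1 y
    nlinarith
  refine ⟨?_, hΔ x y⟩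
  rw [F.f_add E (by simp [snR_zero h0.le h1]) (by simp [cnR_zero h0.le h1])
    (by simp [dnR_zero h0.le h1]) hΔ, F.f_add E (by simp [snR_zero h0.le h1])
    (by simp [cnR_zero h0.le h1]) (by simp [dnR_zero h0.le h1]) hΔ]
  simp only [snR_neg h0.le h1, cnR_neg h0.le h1, dnR_neg h0.le h1]
  have h := hΔ x y
  have h1 := F.g_sq x
  have h2 := F.h_sq x
  have h3 := E.g_sq y
  have h4 := E.h_sq y
  push_cast
  rw [neg_sq, div_mul_div_comm, div_eq_div_iff (mul_ne_zero h h) h]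
  generalize (snR q y : ℂ) = s at *
  generalize halfSn q x = f at *
  linear_combination (1 - (q : ℂ) ^ 2 * f ^ 2 * s ^ 2) * (f ^ 2 * (cnR q y : ℂ) ^ 2 * h4
    + f ^ 2 * (1 - (q : ℂ) ^ 2 * s ^ 2) * h3 - s ^ 2 * (halfCn q x) ^ 2 * h2
    - s ^ 2 * (1 - (q : ℂ) ^ 2 * f ^ 2) * h1)

/-- With `γ = 2 x` this is a consequence of the duplication formulas. Together with `snR_half_sq` it
removes the half arguments from the factors. -/
lemma mul_halfSn_sq (h0 : 0 < q) (h1 : q ≤ 1) (γ : ℝ) : q * halfSn q (γ / 2) ^ 2 =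
    (q * snR q γ + Complex.I * dnR q γ) * (snR q γ + Complex.I * cnR q γ) := by
  obtain ⟨x, rfl⟩ : ∃ x, γ = 2 * x := ⟨γ / 2, by ring⟩
  rw [mul_div_cancel_left₀ _ two_ne_zero, snR_two_mul h0.le h1, cnR_two_mul h0.le h1,
    dnR_two_mul h0.le h1, halfSn]
  have F := isJacobiTriple_real h0.le h1
  have hc := F.g_sq x
  have hd := F.h_sq x
  have hr := sqrt_ne_zero_complex h0
  have hr2 := sqrt_sq_complex h0.le
  have hn := one_add_mul_snR_sq_ne_zero h0 x
  have hn' : (1 : ℂ) - q * (snR q x : ℂ) ^ 2 ≠ 0 := by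
    exact_mod_cast (sub_pos.2 (mul_snR_sq_lt_one h0.le h1 x)).ne'
  have hI := Complex.I_sq
  have hf : (1 : ℂ) - q ^ 2 * (snR q x : ℂ) ^ 4 =
      (1 - q * (snR q x : ℂ) ^ 2) * (1 + q * (snR q x : ℂ) ^ 2) := by ring
  push_cast
  rw [hf]
  field_simp
  rw [hr2]
  generalize (snR q x : ℂ) = s at *
  generalize (cnR q x : ℂ) = c at *
  generalize (dnR q x : ℂ) = d at *
  grind

lemma snR_half_sq (h0 : 0 < q) (h1 : q ≤ 1) (γ : ℝ) :
    snR q (γ / 2) ^ 2 * (1 + dnR q γ) = 1 - cnR q γ := by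
  obtain ⟨x, rfl⟩ : ∃ x, γ = 2 * x := ⟨γ / 2, by ring⟩
  rw [mul_div_cancel_left₀ _ two_ne_zero, cnR_two_mul h0.le h1, dnR_two_mul h0.le h1]
  have hc := snR_sq_add_cnR_sq q x
  have hd := dnR_sq h0.le h1 x
  have hpos := (duplication_denominator_pos h0.le h1 x).ne'
  field_simp
  grind

/-- The factor of the product equation is the negative of the inverse of a phase. -/
lemma phase_mul_gammaFactor (h0 : 0 < q) (h1 : q ≤ 1) (γ γ' : ℝ) :
    (dnR q γ + Complex.I * (q * cnR q γ' * snR q γ)) *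
      (cnR q γ + Complex.I * (dnR q γ' * snR q γ)) *
      (q * (halfSn q (γ / 2 + γ' / 2) * halfSn q (γ / 2 + -(γ' / 2)))) =
    -(1 - (q : ℂ) ^ 2 * snR q γ ^ 2 * snR q γ' ^ 2) := by
  obtain ⟨h, hΔ⟩ := halfSn_mul_halfSn h0 h1 (γ / 2) (γ' / 2)
  have hZ := mul_halfSn_sq h0 h1 γ
  have hσ : (snR q (γ' / 2) : ℂ) ^ 2 * (1 + dnR q γ') = 1 - cnR q γ' := by
    exact_mod_cast snR_half_sq h0 h1 γ'
  have hd0 : (1 : ℂ) + dnR q γ' ≠ 0 := by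
    exact_mod_cast (add_pos zero_lt_one (dnR_pos h0.le h1 γ')).ne'
  have F := isJacobiTriple_real h0.le h1
  have hc := F.g_sq γ
  have hd := F.h_sq γ
  have hc' := F.g_sq γ'
  have hd' := F.h_sq γ'
  have hI := Complex.I_sq
  rw [h, ← mul_div_assoc, ← mul_div_assoc, div_eq_iff hΔ]
  apply mul_right_cancel₀ hd0
  generalize (snR q γ : ℂ) = s at *
  generalize (cnR q γ : ℂ) = c at *
  generalize (dnR q γ : ℂ) = d at *
  generalize (snR q γ' : ℂ) = s' at *
  generalize (cnR q γ' : ℂ) = c' at *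
  generalize (dnR q γ' : ℂ) = d' at *
  generalize (snR q (γ' / 2) : ℂ) = σ at *
  generalize halfSn q (γ / 2) = f at *
  -- Once `sn² (γ' / 2)` is replaced by `(1 - cn γ') / (1 + dn γ')` and the denominator is cleared,
  -- the claim is linear in `q f²`, for which `hZ` gives the value.
  have key : (c + Complex.I * (d' * s)) * (q * f ^ 2 * (1 + d') - q * (1 - c')) +
      (d - Complex.I * (q * c' * s)) * ((1 + d') - q * (q * f ^ 2) * (1 - c')) = 0 := by
    rw [hZ]
    clear hZ h hΔ hσ hd0
    grind
  -- The right-hand side of the goal contains the first phase as a factor, so only the relation `e2`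
  -- for the second phase is left.
  have e1 : 1 - (q : ℂ) ^ 2 * s ^ 2 * s' ^ 2 =
      (d + Complex.I * (q * c' * s)) * (d - Complex.I * (q * c' * s)) := by
    linear_combination (q : ℂ) ^ 2 * c' ^ 2 * s ^ 2 * hI - hd - (q : ℂ) ^ 2 * s ^ 2 * hc'
  rw [e1]
  have e2 : (c + Complex.I * (d' * s)) * (q * (f ^ 2 - σ ^ 2)) * (1 + d') =
      -(d - Complex.I * (q * c' * s)) * (1 - (q : ℂ) ^ 2 * f ^ 2 * σ ^ 2) * (1 + d') := by
    linear_combination key + (-(c + Complex.I * (d' * s)) * q -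
      (d - Complex.I * (q * c' * s)) * q ^ 2 * f ^ 2) * hσ
  linear_combination (d + Complex.I * (q * c' * s)) * e2

end Factor

/-! ## Disk coordinates and parallel transport -/

section Disk

lemma sub_conj_ne_zero (p k : ℍ) : (k : ℂ) - (starRingEnd ℂ) (p : ℂ) ≠ 0 := fun h => by
  have h1 := congrArg Complex.im h
  have h2 := p.im_pos
  have h3 := k.im_pos
  simp at h1
  linarith

lemma toDisk_injective (p : ℍ) : Function.Injective (toDisk p) := fun k k' h => by
  have h1 := sub_conj_ne_zero p k
  have h2 := sub_conj_ne_zero p k'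
  have h3 := sub_conj_ne_zero p p
  rw [toDisk, toDisk, div_eq_div_iff h1 h2] at h
  apply UpperHalfPlane.ext
  exact mul_right_cancel₀ h3 (by linear_combination h)

lemma norm_toDisk (p k : ℍ) : ‖toDisk p k‖ = Real.tanh (dist p k / 2) := by
  rw [dist_comm, UpperHalfPlane.tanh_half_dist, toDisk, norm_div, Complex.dist_eq,
    Complex.dist_eq]

/-- The unit complex number by which directions at `p` turn, in disk coordinates, when they are
transported along the geodesic from `p` to `k`. -/
def transport (p k : ℍ) : Circle :=
  ⟨((k : ℂ) - (starRingEnd ℂ) (p : ℂ)) / ((p : ℂ) - (starRingEnd ℂ) (k : ℂ)), mem_sphere_zero_iff_norm.2 <| by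
    rw [norm_div, div_eq_one_iff_eq
      (norm_ne_zero_iff.2 (sub_conj_ne_zero k p)), ← Complex.norm_conj, map_sub, Complex.conj_conj,
      ← norm_neg, neg_sub]⟩

lemma coe_transport (p k : ℍ) : (transport p k : ℂ) =
    ((k : ℂ) - (starRingEnd ℂ) (p : ℂ)) / ((p : ℂ) - (starRingEnd ℂ) (k : ℂ)) := rfl

lemma transport_mul_transport (p k : ℍ) : transport p k * transport k p = 1 := by
  apply Circle.ext
  have h1 := sub_conj_ne_zero p k
  have h2 := sub_conj_ne_zero k p
  rw [Circle.coe_mul, coe_transport, coe_transport, Circle.coe_one]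
  field_simp

lemma toDisk_swap (p k : ℍ) : toDisk k p = -(toDisk p k * transport p k) := by
  have h1 := sub_conj_ne_zero p k
  have h2 := sub_conj_ne_zero k p
  rw [coe_transport, toDisk, toDisk]
  field_simp
  ring

/-- Changing the base point from `p` to `k` is the Möbius map of the disk that sends `toDisk p k` to
0, followed by the rotation `transport p k`. -/
lemma toDisk_mul (p k k' : ℍ) :
    toDisk k k' * (1 - (starRingEnd ℂ) (toDisk p k) * toDisk p k') =
      (toDisk p k' - toDisk p k) * transport p k := by
  have h1 := sub_conj_ne_zero p k
  have h2 := sub_conj_ne_zero k p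
  have h3 := sub_conj_ne_zero p k'
  have h4 := sub_conj_ne_zero k k'
  have h5 : (starRingEnd ℂ) (k : ℂ) - p ≠ 0 := by rw [← neg_sub]; exact neg_ne_zero.2 h2
  rw [coe_transport, toDisk, toDisk, toDisk, map_div₀, map_sub, map_sub, Complex.conj_conj]
  field_simp
  ring

/-- The point with disk coordinate `ζ` with respect to `p`. -/
def ofDisk (p : ℍ) (ζ : ℂ) (hζ : ‖ζ‖ < 1) : ℍ :=
  ⟨((p : ℂ) - ζ * (starRingEnd ℂ) (p : ℂ)) / (1 - ζ), by
    have h1 : 1 - ζ ≠ 0 := fun h => by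
      rw [← sub_eq_zero.1 h, norm_one] at hζ
      exact lt_irrefl _ hζ
    have h2 : 0 < Complex.normSq (1 - ζ) := Complex.normSq_pos.2 h1
    have h3 : Complex.normSq ζ < 1 := by
      rw [Complex.normSq_eq_norm_sq]
      nlinarith [norm_nonneg ζ]
    rw [Complex.div_im, ← sub_div]
    refine div_pos ?_ h2
    have h4 := mul_pos p.im_pos (sub_pos.2 h3)
    rw [Complex.normSq_apply] at h4
    simp
    linarith⟩

lemma toDisk_ofDisk (p : ℍ) (ζ : ℂ) (hζ : ‖ζ‖ < 1) : toDisk p (ofDisk p ζ hζ) = ζ := by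
  have h1 : 1 - ζ ≠ 0 := fun h => by
    rw [← sub_eq_zero.1 h, norm_one] at hζ
    exact lt_irrefl _ hζ
  rw [toDisk, div_eq_iff (sub_conj_ne_zero p _)]
  change ((p : ℂ) - ζ * (starRingEnd ℂ) (p : ℂ)) / (1 - ζ) - p =
    ζ * (((p : ℂ) - ζ * (starRingEnd ℂ) (p : ℂ)) / (1 - ζ) - (starRingEnd ℂ) (p : ℂ))
  field_simp
  ring

lemma tanh_abs (x : ℝ) : Real.tanh |x| = |Real.tanh x| := by
  rw [Real.tanh_eq_sinh_div_cosh, Real.tanh_eq_sinh_div_cosh, abs_div, Real.abs_sinh,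
    Real.cosh_abs, abs_of_pos (Real.cosh_pos x)]

/-- The disk coordinate has modulus `tanh (dist p k / 2)`, and `tanh` is injective, so the distance
condition is implied. -/
lemma hasNormal_iff {k p : ℍ} {r : ℝ} {u : ℂ} :
    HasNormal k r p u ↔ ‖u‖ = 1 ∧ toDisk p k = (Real.tanh (r / 2) : ℂ) * u := by
  refine ⟨fun h => h.2, fun h => ⟨?_, h⟩⟩
  have h1 := norm_toDisk p k
  rw [h.2, norm_mul, h.1, mul_one, Complex.norm_real, Real.norm_eq_abs, ← tanh_abs] at h1
  have h2 := Real.tanh_injective h1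
  rw [abs_div, abs_two] at h2
  linarith

end Disk

/-! ## Right triangles -/

section Triangle

/-- In a right triangle, `toDisk_mul` gives the quotient of `tanh (a / 2) + i tanh (b / 2)` by `1 +
i tanh (a / 2) tanh (b / 2)`; this rewrites it in full arguments. -/
lemma tanh_half_right_triangle (a b : ℝ) :
    ((Real.tanh (a / 2) : ℂ) + Complex.I * Real.tanh (b / 2)) * (1 + Real.cosh a * Real.cosh b) =
      (Real.sinh a * Real.cosh b + Complex.I * Real.sinh b) *
        (1 + Complex.I * (Real.tanh (a / 2) * Real.tanh (b / 2))) := by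
  obtain ⟨x, rfl⟩ : ∃ x, a = 2 * x := ⟨a / 2, by ring⟩
  obtain ⟨y, rfl⟩ : ∃ y, b = 2 * y := ⟨b / 2, by ring⟩
  rw [mul_div_cancel_left₀ _ two_ne_zero, mul_div_cancel_left₀ _ two_ne_zero,
    Real.cosh_two_mul, Real.cosh_two_mul, Real.sinh_two_mul, Real.sinh_two_mul,
    Real.tanh_eq_sinh_div_cosh, Real.tanh_eq_sinh_div_cosh]
  have hx : (Real.cosh x : ℂ) ^ 2 - (Real.sinh x : ℂ) ^ 2 = 1 := by
    exact_mod_cast Real.cosh_sq_sub_sinh_sq x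
  have hy : (Real.cosh y : ℂ) ^ 2 - (Real.sinh y : ℂ) ^ 2 = 1 := by
    exact_mod_cast Real.cosh_sq_sub_sinh_sq y
  have hx0 : (Real.cosh x : ℂ) ≠ 0 := by exact_mod_cast (Real.cosh_pos x).ne'
  have hy0 : (Real.cosh y : ℂ) ≠ 0 := by exact_mod_cast (Real.cosh_pos y).ne'
  have hI := Complex.I_sq
  push_cast at *
  generalize Complex.cosh x = C at *
  generalize Complex.sinh x = S at *
  generalize Complex.cosh y = C' at *
  generalize Complex.sinh y = S' at *
  field_simp
  grind

lemma one_add_I_mul_ofReal_ne_zero (x : ℝ) : 1 + Complex.I * (x : ℂ) ≠ 0 := fun h => by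
  have := congrArg Complex.re h
  simp at this

lemma one_add_cosh_mul_cosh_ne_zero (a b : ℝ) :
    (1 : ℂ) + Real.cosh a * Real.cosh b ≠ 0 := by
  have : (0 : ℝ) < 1 + Real.cosh a * Real.cosh b := by
    have := Real.cosh_pos a
    have := Real.cosh_pos b
    positivity
  exact_mod_cast this.ne'

/-- In a triangle with a right angle at `p` and legs `a`, `b`, the position of the third vertex
`k'` as seen from the second vertex `k`. -/
lemma toDisk_right_triangle {p k k' : ℍ} {u : ℂ} {a b : ℝ} (hu : ‖u‖ = 1)
    (hk : toDisk p k = (Real.tanh (a / 2) : ℂ) * u)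
    (hk' : toDisk p k' = (Real.tanh (b / 2) : ℂ) * -(Complex.I * u)) :
    toDisk k k' = -(u * transport p k * ((Real.sinh a * Real.cosh b + Complex.I * Real.sinh b) /
      (1 + Real.cosh a * Real.cosh b))) := by
  have h := toDisk_mul p k k'
  have huu : (starRingEnd ℂ) u * u = 1 := by
    rw [Complex.conj_mul', hu]; norm_num
  have hA : 1 + Complex.I * ((Real.tanh (a / 2) : ℂ) * Real.tanh (b / 2)) ≠ 0 := by
    have := one_add_I_mul_ofReal_ne_zero (Real.tanh (a / 2) * Real.tanh (b / 2))
    rwa [Complex.ofReal_mul] at this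
  rw [hk, hk', map_mul, Complex.conj_ofReal] at h
  have hD := one_add_cosh_mul_cosh_ne_zero a b
  have ht := tanh_half_right_triangle a b
  apply mul_right_cancel₀ hA
  apply mul_right_cancel₀ hD
  rw [← mul_div_assoc, ← neg_div, div_mul_eq_mul_div, div_mul_cancel₀ _ hD]
  generalize (Real.tanh (a / 2) : ℂ) = A at *
  generalize (Real.tanh (b / 2) : ℂ) = B at *
  linear_combination (1 + (Real.cosh a : ℂ) * Real.cosh b) * h - u * transport p k * ht
    - (1 + (Real.cosh a : ℂ) * Real.cosh b) * Complex.I * A * B * toDisk k k' * huu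

lemma normSq_sinh_mul_cosh (a b : ℝ) :
    Complex.normSq (Real.sinh a * Real.cosh b + Complex.I * Real.sinh b) =
      (Real.cosh a * Real.cosh b) ^ 2 - 1 := by
  have ha := Real.cosh_sq a
  have hb := Real.cosh_sq b
  have : Complex.normSq (Real.sinh a * Real.cosh b + Complex.I * Real.sinh b) =
      (Real.sinh a * Real.cosh b) ^ 2 + Real.sinh b ^ 2 := by
    rw [show (Real.sinh a * Real.cosh b + Complex.I * Real.sinh b : ℂ) =
      ((Real.sinh a * Real.cosh b : ℝ) : ℂ) + (Real.sinh b : ℝ) * Complex.I by push_cast; ring,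
      Complex.normSq_add_mul_I]
  rw [this, mul_pow, mul_pow, ha, hb]
  ring

/-- Theorem of Pythagoras: for points at distance `δ` the left side is `tanh² (δ / 2) = (cosh δ - 1)
/ (cosh δ + 1)`, so `cosh δ = cosh a cosh b`. -/
lemma normSq_toDisk_right_triangle {p k k' : ℍ} {u : ℂ} {a b : ℝ} (hu : ‖u‖ = 1)
    (hk : toDisk p k = (Real.tanh (a / 2) : ℂ) * u)
    (hk' : toDisk p k' = (Real.tanh (b / 2) : ℂ) * -(Complex.I * u)) :
    Complex.normSq (toDisk k k') = (Real.cosh a * Real.cosh b - 1) /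
      (Real.cosh a * Real.cosh b + 1) := by
  rw [toDisk_right_triangle hu hk hk', Complex.normSq_neg, map_mul, map_mul, map_div₀,
    normSq_sinh_mul_cosh, Complex.normSq_eq_norm_sq u, hu, Circle.normSq_coe,
    show (1 : ℂ) + Real.cosh a * Real.cosh b = ((1 + Real.cosh a * Real.cosh b : ℝ) : ℂ) by
      push_cast; ring, Complex.normSq_ofReal]
  have h1 : 0 < Real.cosh a * Real.cosh b := mul_pos (Real.cosh_pos a) (Real.cosh_pos b)
  have h2 : 1 + Real.cosh a * Real.cosh b ≠ 0 := by positivity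
  have h3 : Real.cosh a * Real.cosh b + 1 ≠ 0 := by positivity
  field_simp
  ring

lemma eq_of_sub_one_div_add_one_eq {x y : ℝ} (hx : 0 < x) (hy : 0 < y)
    (h : (x - 1) / (x + 1) = (y - 1) / (y + 1)) : x = y := by
  rw [div_eq_div_iff (by positivity) (by positivity)] at h
  linarith

/-- The quotient of the two normals is `i` or `-i`. The second case becomes the first when the sign
of `b` is reversed, which `cosh` does not notice. -/
lemma MeetOrthogonally.normSq_toDisk {k₁ k₂ : ℍ} {a b : ℝ} (h : MeetOrthogonally k₁ a k₂ b) :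
    Complex.normSq (toDisk k₁ k₂) = (Real.cosh a * Real.cosh b - 1) /
      (Real.cosh a * Real.cosh b + 1) := by
  obtain ⟨p, u, w, ⟨-, hu, h1⟩, ⟨-, hw, h2⟩, huw⟩ := h
  have hww : (starRingEnd ℂ) w * w = 1 := by rw [Complex.conj_mul', hw]; norm_num
  set t := u * (starRingEnd ℂ) w with ht
  have hut : u = t * w := by rw [ht, mul_assoc, hww, mul_one]
  have htn : ‖t‖ = 1 := by rw [ht, norm_mul, Complex.norm_conj, hu, hw, one_mul]
  have ht2 : t = (t.im : ℂ) * Complex.I := by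
    apply Complex.ext <;> simp [huw]
  have him : t.im ^ 2 = 1 := by
    rw [ht2, norm_mul, Complex.norm_I, mul_one, Complex.norm_real, Real.norm_eq_abs] at htn
    rw [← sq_abs, htn, one_pow]
  have hI := Complex.I_sq
  rcases sq_eq_sq_iff_eq_or_eq_neg.1 (him.trans (one_pow 2).symm) with hi | hi
  · rw [hi] at ht2
    refine normSq_toDisk_right_triangle hu h1 ?_
    rw [h2, hut, ht2, Complex.ofReal_one]
    linear_combination (Real.tanh (b / 2) : ℂ) * w * hI
  · rw [hi] at ht2
    rw [← Real.cosh_neg b]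
    refine normSq_toDisk_right_triangle hu h1 ?_
    rw [h2, hut, ht2, neg_div, Real.tanh_neg, Complex.ofReal_neg, Complex.ofReal_neg,
      Complex.ofReal_one]
    linear_combination (Real.tanh (b / 2) : ℂ) * w * hI

end Triangle

/-! ## Frames -/

section Frames

/-- A unit direction at a point of the hyperbolic plane. -/
abbrev Frame := ℍ × Circle

lemma norm_tanh_mul_lt_one (t : ℝ) (u : Circle) : ‖(Real.tanh (t / 2) : ℂ) * u‖ < 1 := by
  rw [norm_mul, Circle.norm_coe, mul_one, Complex.norm_real]
  exact Real.abs_tanh_lt_one _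

/-- Move a frame by the signed distance `t` in its own direction. -/
def advance (t : ℝ) (F : Frame) : Frame :=
  let k := ofDisk F.1 ((Real.tanh (t / 2) : ℂ) * F.2) (norm_tanh_mul_lt_one t F.2)
  (k, F.2 * transport F.1 k)

lemma toDisk_advance (t : ℝ) (F : Frame) :
    toDisk F.1 (advance t F).1 = (Real.tanh (t / 2) : ℂ) * F.2 :=
  toDisk_ofDisk _ _ (norm_tanh_mul_lt_one t F.2)

lemma advance_snd (t : ℝ) (F : Frame) :
    (advance t F).2 = F.2 * transport F.1 (advance t F).1 := rfl

lemma advance_fst_eq {t : ℝ} {F : Frame} {k : ℍ}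
    (h : toDisk F.1 k = (Real.tanh (t / 2) : ℂ) * F.2) : (advance t F).1 = k :=
  toDisk_injective F.1 ((toDisk_advance t F).trans h.symm)

lemma hasNormal_advance (t : ℝ) (F : Frame) : HasNormal (advance t F).1 t F.1 F.2 :=
  hasNormal_iff.2 ⟨Circle.norm_coe _, toDisk_advance t F⟩

lemma advance_neg_advance (t : ℝ) (F : Frame) : advance (-t) (advance t F) = F := by
  have h : (advance (-t) (advance t F)).1 = F.1 := by
    apply advance_fst_eq
    rw [toDisk_swap, toDisk_advance, advance_snd, neg_div, Real.tanh_neg, Circle.coe_mul]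
    push_cast
    ring
  refine Prod.ext h ?_
  rw [advance_snd, h, advance_snd, mul_assoc, transport_mul_transport, mul_one]

/-- The permutation of the frames given by `advance`. -/
def advancePerm (t : ℝ) : Equiv.Perm Frame where
  toFun := advance t
  invFun := advance (-t)
  left_inv := advance_neg_advance t
  right_inv F := by simpa using advance_neg_advance (-t) F

/-- Rotate frames by a fixed angle. -/
def rotate (α : Circle) : Equiv.Perm Frame where
  toFun F := (F.1, α * F.2)
  invFun F := (F.1, α⁻¹ * F.2)
  left_inv F := by simp
  right_inv F := by simp

lemma rotate_apply (α : Circle) (F : Frame) : rotate α F = (F.1, α * F.2) := rfl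

lemma rotate_rotate (α β : Circle) (F : Frame) : rotate α (rotate β F) = rotate (α * β) F := by
  simp [rotate_apply, mul_assoc]

lemma rotate_one (F : Frame) : rotate 1 F = F := by simp [rotate_apply]

/-- The imaginary unit on the circle. -/
def circleI : Circle := ⟨Complex.I, by simp [Submonoid.unitSphere]⟩

lemma coe_circleI : (circleI : ℂ) = Complex.I := rfl

lemma coe_circleI_inv : ((circleI⁻¹ : Circle) : ℂ) = -Complex.I := by
  rw [Circle.coe_inv, coe_circleI, Complex.inv_I]

/-- The unit complex number in the direction of `z`. -/
def direction (z : ℂ) : Circle := Circle.exp z.arg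

lemma norm_mul_direction (z : ℂ) : (‖z‖ : ℂ) * direction z = z := by
  rw [direction, Circle.coe_exp, Complex.norm_mul_exp_arg_mul_I]

/-- The angle at the vertex `k` of a quadrilateral `p k' p' k` with right angles at `p` and `p'`
and with the (signed) sides `p k = a`, `p k' = b`, `p' k = c`, `p' k' = e`. -/
def kiteAngle (a b c e : ℝ) : Circle :=
  direction (Real.sinh a * Real.cosh b + Complex.I * Real.sinh b) *
    direction (Real.sinh c * Real.cosh e + Complex.I * Real.sinh e)

lemma kiteAngle_swap (a b c e : ℝ) : kiteAngle a b c e = kiteAngle c e a b := mul_comm _ _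

/-- Both factors on the right have squared modulus `cosh² - 1` of their hypotenuse. For equal
hypotenuses the product of the moduli is therefore a real polynomial, without square roots. -/
lemma coe_kiteAngle_mul {a b c e : ℝ}
    (h : Real.cosh a * Real.cosh b = Real.cosh c * Real.cosh e) :
    (((Real.cosh a * Real.cosh b) ^ 2 - 1 : ℝ) : ℂ) * kiteAngle a b c e =
      (Real.sinh a * Real.cosh b + Complex.I * Real.sinh b) *
        (Real.sinh c * Real.cosh e + Complex.I * Real.sinh e) := by
  have h1 := normSq_sinh_mul_cosh a b
  have h2 := normSq_sinh_mul_cosh c e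
  rw [← h, ← h1, Complex.normSq_eq_norm_sq, Complex.normSq_eq_norm_sq,
    sq_eq_sq₀ (norm_nonneg _) (norm_nonneg _)] at h2
  have d1 := norm_mul_direction (Real.sinh a * Real.cosh b + Complex.I * Real.sinh b)
  have d2 := norm_mul_direction (Real.sinh c * Real.cosh e + Complex.I * Real.sinh e)
  rw [h2] at d2
  rw [← h1, Complex.normSq_eq_norm_sq, kiteAngle, Circle.coe_mul, Complex.ofReal_pow]
  linear_combination (Real.sinh c * Real.cosh e + Complex.I * Real.sinh e) * d1 +
    ‖(Real.sinh a * Real.cosh b + Complex.I * Real.sinh b : ℂ)‖ *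
    direction (Real.sinh a * Real.cosh b + Complex.I * Real.sinh b) * d2

lemma toDisk_advance_rotate_inv (b : ℝ) (F : Frame) :
    toDisk F.1 (advance b (rotate circleI⁻¹ F)).1 =
      (Real.tanh (b / 2) : ℂ) * -(Complex.I * F.2) := by
  have h := toDisk_advance b (rotate circleI⁻¹ F)
  rwa [show (rotate circleI⁻¹ F).2 = circleI⁻¹ * F.2 from rfl, Circle.coe_mul, coe_circleI_inv,
    neg_mul] at h

lemma toDisk_advance_rotate (b : ℝ) (F : Frame) :
    toDisk F.1 (advance b (rotate circleI F)).1 =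
      (Real.tanh (-b / 2) : ℂ) * -(Complex.I * F.2) := by
  have h := toDisk_advance b (rotate circleI F)
  rw [show (rotate circleI F).2 = circleI * F.2 from rfl, Circle.coe_mul, coe_circleI] at h
  rw [neg_div, Real.tanh_neg, Complex.ofReal_neg, neg_mul_neg]
  exact h

lemma toDisk_advance_advance (a b : ℝ) (F : Frame) :
    toDisk (advance a F).1 (advance b (rotate circleI⁻¹ F)).1 =
      -((advance a F).2 * ((Real.sinh a * Real.cosh b + Complex.I * Real.sinh b) /
      (1 + Real.cosh a * Real.cosh b))) := by
  rw [toDisk_right_triangle (Circle.norm_coe _) (toDisk_advance a F)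
    (toDisk_advance_rotate_inv b F), advance_snd, Circle.coe_mul]

lemma toDisk_advance_advance' (a b : ℝ) (F : Frame) :
    toDisk (advance a F).1 (advance b (rotate circleI F)).1 =
      -((advance a F).2 * ((Real.sinh a * Real.cosh b - Complex.I * Real.sinh b) /
      (1 + Real.cosh a * Real.cosh b))) := by
  rw [toDisk_right_triangle (Circle.norm_coe _) (toDisk_advance a F)
    (toDisk_advance_rotate b F), advance_snd, Circle.coe_mul, Real.cosh_neg, Real.sinh_neg,
    Complex.ofReal_neg, mul_neg, sub_eq_add_neg]

lemma mul_conj_sinh_mul_cosh (a b : ℝ) :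
    ((Real.sinh a * Real.cosh b + Complex.I * Real.sinh b) : ℂ) *
      (Real.sinh a * Real.cosh b - Complex.I * Real.sinh b) =
      (((Real.cosh a * Real.cosh b) ^ 2 - 1 : ℝ) : ℂ) := by
  rw [← normSq_sinh_mul_cosh, ← Complex.mul_conj]
  simp only [map_add, map_mul, Complex.conj_ofReal, Complex.conj_I]
  ring

/-- Two right triangles with a common hypotenuse form a quadrilateral, the angle of which is
given by its sides. -/
lemma kite_closed {F₁ F₂ : Frame} {a b c e : ℝ} (h1 : (advance a F₁).1 = (advance c F₂).1)
    (h2 : (advance b (rotate circleI⁻¹ F₁)).1 = (advance e (rotate circleI F₂)).1)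
    (hD : 1 < Real.cosh a * Real.cosh b) :
    Real.cosh a * Real.cosh b = Real.cosh c * Real.cosh e ∧
      (advance c F₂).2 = kiteAngle a b c e * (advance a F₁).2 := by
  have t1 := toDisk_advance_advance a b F₁
  have t2 := toDisk_advance_advance' c e F₂
  rw [← h1, ← h2] at t2
  have hD1 := one_add_cosh_mul_cosh_ne_zero a b
  have hD' : Real.cosh a * Real.cosh b = Real.cosh c * Real.cosh e := by
    have n1 := normSq_toDisk_right_triangle (Circle.norm_coe _) (toDisk_advance a F₁)
      (toDisk_advance_rotate_inv b F₁)
    have n2 := normSq_toDisk_right_triangle (Circle.norm_coe _) (toDisk_advance c F₂)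
      (toDisk_advance_rotate e F₂)
    rw [← h1, ← h2, n1, Real.cosh_neg] at n2
    exact eq_of_sub_one_div_add_one_eq (mul_pos (Real.cosh_pos _) (Real.cosh_pos _))
      (mul_pos (Real.cosh_pos _) (Real.cosh_pos _)) n2
  refine ⟨hD', Circle.ext ?_⟩
  have hk := coe_kiteAngle_mul hD'
  have hc := mul_conj_sinh_mul_cosh c e
  rw [← hD'] at hc
  have h0 : (((Real.cosh a * Real.cosh b) ^ 2 - 1 : ℝ) : ℂ) ≠ 0 := by
    have : 0 < (Real.cosh a * Real.cosh b) ^ 2 - 1 := by nlinarith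
    exact_mod_cast this.ne'
  have hD'' : (Real.cosh a : ℂ) * Real.cosh b = Real.cosh c * Real.cosh e := by exact_mod_cast hD'
  -- Both triangles locate the same vertex as seen from their common one; comparing the two
  -- positions yields the rotation between the two frames there.
  rw [t1, ← hD'', neg_inj, ← mul_div_assoc, ← mul_div_assoc, div_left_inj' hD1] at t2
  apply mul_left_cancel₀ h0
  rw [Circle.coe_mul, ← mul_assoc, hk]
  linear_combination (-((advance c F₂).2 : ℂ)) * hc
    - (Real.sinh c * Real.cosh e + Complex.I * Real.sinh e) * t2

/-- If the angle between two right triangles with a common vertex and equal hypotenuses is right,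
they have the hypotenuse in common. -/
lemma kite_close {F₁ F₂ : Frame} {a b c e : ℝ}
    (h : advance c F₂ = rotate (kiteAngle a b c e) (advance a F₁))
    (hD : 1 < Real.cosh a * Real.cosh b)
    (hD' : Real.cosh a * Real.cosh b = Real.cosh c * Real.cosh e) :
    advance b (rotate circleI⁻¹ F₁) =
      rotate (kiteAngle e c b a) (advance e (rotate circleI F₂)) := by
  have h1 : (advance c F₂).1 = (advance a F₁).1 := by rw [h, rotate_apply]
  have h2 : (advance c F₂).2 = kiteAngle a b c e * (advance a F₁).2 := by rw [h, rotate_apply]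
  have t1 := toDisk_advance_advance a b F₁
  have t2 := toDisk_advance_advance' c e F₂
  have hk := coe_kiteAngle_mul hD'
  have hc := mul_conj_sinh_mul_cosh c e
  rw [← hD'] at hc
  have h0 : (((Real.cosh a * Real.cosh b) ^ 2 - 1 : ℝ) : ℂ) ≠ 0 := by
    have : 0 < (Real.cosh a * Real.cosh b) ^ 2 - 1 := by nlinarith
    exact_mod_cast this.ne'
  have hD'' : (Real.cosh a : ℂ) * Real.cosh b = Real.cosh c * Real.cosh e := by exact_mod_cast hD'
  have h3 : (advance b (rotate circleI⁻¹ F₁)).1 = (advance e (rotate circleI F₂)).1 := by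
    apply toDisk_injective (advance a F₁).1
    rw [t1, ← h1, t2, h2, ← hD'', neg_inj, ← mul_div_assoc, ← mul_div_assoc]
    congr 1
    apply mul_left_cancel₀ h0
    rw [Circle.coe_mul]
    linear_combination (-((advance a F₁).2 : ℂ)) *
      (Real.sinh c * Real.cosh e - Complex.I * Real.sinh e) * hk -
      ((advance a F₁).2 : ℂ) * (Real.sinh a * Real.cosh b + Complex.I * Real.sinh b) * hc
  -- The same kite seen from its other center: quarter turns of the frames at the touching points
  -- exchange the legs, and the two triangles trade places.
  have h4 := kite_closed (F₁ := rotate circleI F₂) (F₂ := rotate circleI⁻¹ F₁) (a := e) (b := c)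
    (c := b) (e := a) h3.symm (by simpa [rotate_rotate, rotate_one] using h1)
    (by rw [mul_comm (Real.cosh e), ← hD']; exact hD)
  exact Prod.ext h3 h4.2

end Frames

/-! ## Developing a flat cocycle over a simply connected complex -/

section Developing

variable {S : Set (ℤ × ℤ)} {Γ : Type*} [Group Γ] (H : ℤ × ℤ → ℤ × ℤ → Γ)

/-- The product of a cocycle along a list of vertices. -/
def holonomy : List (ℤ × ℤ) → Γ
  | [] => 1
  | [_] => 1
  | x :: y :: l => holonomy (y :: l) * H x y

lemma holonomy_append (l : List (ℤ × ℤ)) (x : ℤ × ℤ) (m : List (ℤ × ℤ)) :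
    holonomy H (l ++ x :: m) = holonomy H (x :: m) * holonomy H (l ++ [x]) := by
  induction l with
  | nil => simp [holonomy]
  | cons a l ih =>
    cases l with
    | nil => simp [holonomy]
    | cons b l =>
      simp only [List.cons_append, holonomy] at ih ⊢
      rw [ih, mul_assoc]

lemma Edge.symm {x y : ℤ × ℤ} (h : Edge S x y) : Edge S y x := by
  obtain ⟨s, hs, h1, h2, h3⟩ := h
  refine ⟨s, hs, h2, h1, ?_⟩
  rw [abs_sub_comm y.1, abs_sub_comm y.2, h3]

variable {H} (hback : ∀ x y, Edge S x y → H y x * H x y = 1)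

include hback

lemma holonomy_reverse (l : List (ℤ × ℤ)) (hl : l.IsChain (Edge S)) :
    holonomy H l.reverse = (holonomy H l)⁻¹ := by
  induction l with
  | nil => simp [holonomy]
  | cons a l ih =>
    cases l with
    | nil => simp [holonomy]
    | cons b l =>
      rw [List.isChain_cons_cons] at hl
      have h := ih hl.2
      rw [List.reverse_cons, List.reverse_cons, List.append_assoc, List.singleton_append,
        holonomy_append, ← List.reverse_cons, h, holonomy, holonomy, holonomy, one_mul,
        mul_inv_rev, eq_inv_of_mul_eq_one_left (hback a b hl.1)]

variable (hsq : ∀ s x y z w, s ∈ S → IsSide s x y → IsSide s y z → IsSide s z w → IsSide s w x →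
    x ≠ z → y ≠ w → H y z * H x y = H w z * H x w)

include hsq

lemma holonomy_eq_of_elemHomotopy {l l' : List (ℤ × ℤ)} (h : ElemHomotopy S l l') :
    holonomy H l = holonomy H l' := by
  cases h with
  | backtrack l l' x y h =>
    rw [List.append_assoc, List.append_assoc, List.cons_append, List.singleton_append,
      holonomy_append, holonomy_append H l x l']
    simp only [List.cons_append, List.nil_append, holonomy]
    rw [mul_assoc (holonomy H (x :: l')), hback x y h, mul_one]
  | square l l' s x y z w hs hxy hyz hzw hwx hxz hyw =>
    simp only [List.append_assoc, List.cons_append, List.nil_append]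
    rw [holonomy_append, holonomy_append H l x (w :: z :: l')]
    simp only [holonomy]
    rw [mul_assoc (holonomy H (z :: l')), mul_assoc (holonomy H (z :: l')),
      hsq s x y z w hs hxy hyz hzw hwx hxz hyw]
    simp only [mul_assoc]

/-- `g x` is the holonomy of a chosen path from a base vertex to `x`. The path to `x`, the edge to
`y` and the reversed path to `y` form a closed path. It is homotopic to a constant one, so its
holonomy is trivial. -/
lemma exists_developing (hS : IsSimplyConnected S) :
    ∃ g : ℤ × ℤ → Γ, ∀ x y, Edge S x y → g y = H x y * g x := by
  by_cases hne : ∃ b, ∃ s ∈ S, IsCorner b s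
  swap
  · exact ⟨1, fun x y ⟨s, hs, hx, _⟩ => absurd ⟨x, s, hs, hx⟩ hne⟩
  obtain ⟨b, hb⟩ := hne
  have hpath : ∀ x, (∃ s ∈ S, IsCorner x s) → ∃ p : List (ℤ × ℤ), p.IsChain (Edge S) ∧
      (∃ l, p = b :: l) ∧ ∃ l, p = l ++ [x] := by
    intro x hx
    induction hS.1 b x hb hx with
    | refl => exact ⟨[b], List.isChain_singleton b, ⟨[], rfl⟩, ⟨[], rfl⟩⟩
    | @tail y z h1 h2 ih =>
      obtain ⟨s, hs, hy, hz, -⟩ := id h2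
      obtain ⟨p, hp, ⟨l, hl⟩, ⟨l', hl'⟩⟩ := ih ⟨s, hs, hy⟩
      refine ⟨p ++ [z], ?_, ⟨l ++ [z], by rw [hl, List.cons_append]⟩, ⟨p, rfl⟩⟩
      refine hp.append (List.isChain_singleton z) fun a ha c hc => ?_
      rw [hl', List.getLast?_concat, Option.mem_some_iff] at ha
      rw [List.head?_cons, Option.mem_some_iff] at hc
      rwa [← ha, ← hc]
  choose! p hp hp1 hp2 using hpath
  refine ⟨fun x => holonomy H (p x), fun x y hxy => ?_⟩
  obtain ⟨s, hs, hx, hy, -⟩ := id hxy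
  have hx' : ∃ s ∈ S, IsCorner x s := ⟨s, hs, hx⟩
  have hy' : ∃ s ∈ S, IsCorner y s := ⟨s, hs, hy⟩
  obtain ⟨lx, hlx⟩ := hp1 x hx'
  obtain ⟨lx', hlx'⟩ := hp2 x hx'
  obtain ⟨ly, hly⟩ := hp1 y hy'
  obtain ⟨ly', hly'⟩ := hp2 y hy'
  have hrev : (p y).reverse = y :: ly'.reverse := by rw [hly']; simp
  have hrev' : (p y).reverse = ly.reverse ++ [b] := by rw [hly]; simp
  have hchain : (p x ++ (p y).reverse).IsChain (Edge S) := by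
    refine (hp x hx').append ?_ fun a ha c hc => ?_
    · rw [List.isChain_reverse]
      exact (hp y hy').imp fun _ _ h => h.symm
    · rw [hlx', List.getLast?_concat, Option.mem_some_iff] at ha
      rw [hrev, List.head?_cons, Option.mem_some_iff] at hc
      rwa [← ha, ← hc]
  have hloop : p x ++ (p y).reverse = b :: ((lx ++ ly.reverse) ++ [b]) := by
    rw [hlx, hrev', List.cons_append, List.append_assoc]
  have h1 : holonomy H (p x ++ (p y).reverse) = 1 := by
    rw [hloop] at hchain ⊢
    have h := hS.2 b _ hchain
    have h' : ∀ l l', Relation.EqvGen (ElemHomotopy S) l l' → holonomy H l = holonomy H l' := by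
      intro l l' h
      induction h with
      | rel _ _ h => exact holonomy_eq_of_elemHomotopy hback hsq h
      | refl _ => rfl
      | symm _ _ _ ih => exact ih.symm
      | trans _ _ _ _ _ ih1 ih2 => exact ih1.trans ih2
    rw [h' _ _ h, holonomy]
  have h2 : p x ++ (p y).reverse = lx' ++ x :: (y :: ly'.reverse) := by
    rw [hrev, hlx', List.append_assoc, List.singleton_append]
  rw [h2, holonomy_append, holonomy, ← hrev, ← hlx', holonomy_reverse hback _ (hp y hy'),
    mul_assoc, inv_mul_eq_one] at h1
  exact h1

end Developing

/-! ## Steps and corners -/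

section Steps

/-- The rotation of the grid by a right angle. -/
def rot90 (d : ℤ × ℤ) : ℤ × ℤ := (-d.2, d.1)

/-- The four unit vectors of the grid. -/
def IsUnitStep (d : ℤ × ℤ) : Prop := d = (1, 0) ∨ d = (0, 1) ∨ d = (-1, 0) ∨ d = (0, -1)

/-- A unit vector of the grid as a complex number. -/
def stepCircle (d : ℤ × ℤ) : Circle :=
  if d = (1, 0) then 1 else if d = (0, 1) then circleI else if d = (-1, 0) then circleI ^ 2
  else circleI ^ 3

lemma circleI_pow_four : circleI ^ 4 = 1 := by
  apply Circle.ext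
  rw [Circle.coe_pow, coe_circleI, Complex.I_pow_four, Circle.coe_one]

lemma IsUnitStep.rot90 {d : ℤ × ℤ} (hd : IsUnitStep d) : IsUnitStep (rot90 d) := by
  rcases hd with rfl | rfl | rfl | rfl <;> simp [RingPattern.rot90, IsUnitStep]

lemma IsUnitStep.neg {d : ℤ × ℤ} (hd : IsUnitStep d) : IsUnitStep (-d) := by
  rcases hd with rfl | rfl | rfl | rfl <;> simp [IsUnitStep]

lemma stepCircle_rot90 {d : ℤ × ℤ} (hd : IsUnitStep d) :
    stepCircle (rot90 d) = circleI * stepCircle d := by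
  have h := circleI_pow_four
  rcases hd with rfl | rfl | rfl | rfl <;> simp [rot90, stepCircle, ← pow_succ', h, ← sq]

lemma rot90_neg (d : ℤ × ℤ) : rot90 (-d) = -rot90 d := rfl

lemma rot90_rot90 (d : ℤ × ℤ) : rot90 (rot90 d) = -d := rfl

lemma stepCircle_neg {d : ℤ × ℤ} (hd : IsUnitStep d) :
    stepCircle (-d) = circleI * (circleI * stepCircle d) := by
  rw [← rot90_rot90, stepCircle_rot90 hd.rot90, stepCircle_rot90 hd]

lemma stepCircle_neg_rot90 {d : ℤ × ℤ} (hd : IsUnitStep d) :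
    stepCircle (-rot90 d) = circleI⁻¹ * stepCircle d := by
  have h : circleI⁻¹ = circleI * circleI * circleI := by
    rw [inv_eq_iff_mul_eq_one, ← circleI_pow_four]
    simp only [pow_succ, pow_zero, one_mul, mul_assoc]
  rw [stepCircle_neg hd.rot90, stepCircle_rot90 hd, h, mul_assoc, mul_assoc]

lemma coe_stepCircle_mul (u : ℂ) : (stepCircle (1, 0) : ℂ) * u = u ∧
    (stepCircle (0, 1) : ℂ) * u = Complex.I * u ∧ (stepCircle (-1, 0) : ℂ) * u = -u ∧
    (stepCircle (0, -1) : ℂ) * u = -(Complex.I * u) := by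
  simp [stepCircle, coe_circleI, Complex.I_sq, Complex.I_pow_three]

variable {S : Set (ℤ × ℤ)}

/-- The complex has the square at `v` with the sides `d` and `rot90 d`. -/
def HasSquare (S : Set (ℤ × ℤ)) (v d : ℤ × ℤ) : Prop :=
  ∃ s ∈ S, IsCorner v s ∧ IsCorner (v + d + rot90 d) s

lemma HasSquare.opposite {v d : ℤ × ℤ} (h : HasSquare S v d) :
    HasSquare S (v + d + rot90 d) (-d) := by
  obtain ⟨s, hs, h1, h2⟩ := h
  refine ⟨s, hs, h2, ?_⟩
  rwa [rot90_neg, show v + d + rot90 d + -d + -rot90 d = v by abel]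

lemma HasSquare.edges {v d : ℤ × ℤ} (hd : IsUnitStep d) (h : HasSquare S v d) :
    Edge S (v + d) v ∧ Edge S (v + rot90 d) v ∧ Edge S (v + d) (v + d + rot90 d) ∧
      Edge S (v + rot90 d) (v + d + rot90 d) := by
  obtain ⟨s, hs, h1, h2⟩ := h
  obtain ⟨a, b⟩ := v
  obtain ⟨m, n⟩ := s
  have key : ∀ x y : ℤ × ℤ, IsSide (m, n) x y → Edge S x y := fun x y h => ⟨_, hs, h⟩
  refine ⟨key _ _ ?_, key _ _ ?_, key _ _ ?_, key _ _ ?_⟩ <;>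
  rcases hd with rfl | rfl | rfl | rfl <;>
  simp only [IsSide, IsCorner, rot90, Prod.mk_add_mk] at h1 h2 ⊢ <;>
  refine ⟨?_, ?_, ?_⟩ <;> first | omega | (norm_num)

lemma isInternal_iff {v : ℤ × ℤ} : IsInternal S v ↔ Even (v.1 + v.2) ∧ HasSquare S v (1, 0) ∧
    HasSquare S v (0, 1) ∧ HasSquare S v (-1, 0) ∧ HasSquare S v (0, -1) := by
  have key : ∀ d s : ℤ × ℤ, (∀ t : ℤ × ℤ, IsCorner v t ∧ IsCorner (v + d + rot90 d) t ↔ t = s) →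
      (HasSquare S v d ↔ s ∈ S) := fun d s h =>
    ⟨fun ⟨t, ht, h1⟩ => (h t).1 h1 ▸ ht, fun hs => ⟨s, hs, (h s).2 rfl⟩⟩
  obtain ⟨a, b⟩ := v
  rw [key (1, 0) (a, b), key (0, 1) (a - 1, b), key (-1, 0) (a - 1, b - 1),
    key (0, -1) (a, b - 1), IsInternal]
  · tauto
  all_goals
    rintro ⟨m, n⟩
    simp only [IsCorner, rot90, Prod.mk_add_mk, Prod.mk.injEq]
    omega

lemma Neighbors.exists_step {v w : ℤ × ℤ} (h : Neighbors S v w) :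
    ∃ d, IsUnitStep d ∧ HasSquare S v d ∧ w = v + d + rot90 d := by
  obtain ⟨hne, hv, hw, s, hs, h1, h2⟩ := h
  obtain ⟨d, hd, h⟩ : ∃ d, IsUnitStep d ∧ w = v + d + rot90 d := by
    obtain ⟨a, b⟩ := v
    obtain ⟨a', b'⟩ := w
    obtain ⟨m, n⟩ := s
    simp only [IsCorner, ne_eq, Prod.mk.injEq] at *
    rw [Int.even_iff] at hv hw
    rcases (by omega : (a' = a + 1 ∧ b' = b + 1) ∨ (a' = a - 1 ∧ b' = b + 1) ∨
      (a' = a - 1 ∧ b' = b - 1) ∨ (a' = a + 1 ∧ b' = b - 1)) with h | h | h | h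
    · exact ⟨(1, 0), by simp [IsUnitStep], by simp [rot90, h]⟩
    · exact ⟨(0, 1), by simp [IsUnitStep], by simp [rot90, h]; ring⟩
    · exact ⟨(-1, 0), by simp [IsUnitStep], by simp [rot90, h]; constructor <;> ring⟩
    · exact ⟨(0, -1), by simp [IsUnitStep], by simp [rot90, h]; ring⟩
  exact ⟨d, hd, ⟨s, hs, h1, h ▸ h2⟩, h⟩

lemma HasSquare.neighbors {v d : ℤ × ℤ} (hd : IsUnitStep d) (hv : Even (v.1 + v.2))
    (h : HasSquare S v d) : Neighbors S v (v + d + rot90 d) := by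
  refine ⟨?_, hv, ?_, h⟩
  · obtain ⟨a, b⟩ := v
    rcases hd with rfl | rfl | rfl | rfl <;> simp [rot90]
  · obtain ⟨a, b⟩ := v
    rw [Int.even_iff] at hv ⊢
    rcases hd with rfl | rfl | rfl | rfl <;> simp [rot90] at hv ⊢ <;> omega

lemma Neighbors.symm {v w : ℤ × ℤ} (h : Neighbors S v w) : Neighbors S w v := by
  obtain ⟨h1, h2, h3, s, hs, h4, h5⟩ := h
  exact ⟨h1.symm, h3, h2, s, hs, h5, h4⟩

lemma Neighbors.mem_right {v w : ℤ × ℤ} (h : Neighbors S v w) : w ∈ ringVertices S := by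
  obtain ⟨h1, h2, h3, s, hs, h4, h5⟩ := h
  exact ⟨⟨s, hs, h5⟩, h3⟩

/-- The end points of an edge differ by a unit vector. -/
lemma Edge.exists_step {x y : ℤ × ℤ} (h : Edge S x y) : ∃ d, IsUnitStep d ∧ x = y + d := by
  obtain ⟨s, -, -, -, h⟩ := h
  obtain ⟨a, b⟩ := x
  obtain ⟨a', b'⟩ := y
  refine ⟨(a - a', b - b'), ?_, by simp⟩
  simp only [IsUnitStep, Prod.mk.injEq] at *
  rcases abs_cases (a - a') with h1 | h1 <;> rcases abs_cases (b - b') with h2 | h2 <;> omega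

lemma odd_add_step {v d : ℤ × ℤ} (hd : IsUnitStep d) (hv : Even (v.1 + v.2)) :
    Odd ((v + d).1 + (v + d).2) := by
  rw [Int.even_iff] at hv
  rw [Int.odd_iff]
  rcases hd with rfl | rfl | rfl | rfl <;> simp <;> omega

/-- Two paths of two sides around a square whose middle vertices are even come from a corner. -/
lemma exists_step_of_sides {s x y z w : ℤ × ℤ} (hs : s ∈ S) (hxy : IsSide s x y)
    (hyz : IsSide s y z) (hzw : IsSide s z w) (hwx : IsSide s w x) (hxz : x ≠ z) (hyw : y ≠ w) :
    ∃ d, IsUnitStep d ∧ HasSquare S y d ∧ w = y + d + rot90 d ∧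
      ((x = y + d ∧ z = y + rot90 d) ∨ (z = y + d ∧ x = y + rot90 d)) := by
  obtain ⟨d, hd, rfl⟩ := Edge.exists_step (S := S) ⟨s, hs, hxy⟩
  obtain ⟨e, he, rfl⟩ := Edge.exists_step (S := S) ⟨s, hs, hyz.2.1, hyz.1,
    by rw [abs_sub_comm, abs_sub_comm z.2]; exact hyz.2.2⟩
  have hc1 := hxy.1
  have hc2 := hyz.2.1
  have hc3 := hxy.2.1
  have hc4 := hwx.1
  have hwx' : w ≠ y + d := by rintro rfl; simpa using hwx.2.2
  have hwz' : w ≠ y + e := by rintro rfl; simpa using hzw.2.2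
  clear hxy hyz hzw hwx
  have hw : w = y + d + e := by
    obtain ⟨a, b⟩ := y
    obtain ⟨m, n⟩ := s
    obtain ⟨a', b'⟩ := w
    rcases hd with rfl | rfl | rfl | rfl <;> rcases he with rfl | rfl | rfl | rfl <;>
    first
      | exact absurd rfl hxz
      | simp only [IsCorner, ne_eq, Prod.mk_add_mk, Prod.mk.injEq]
          at hc1 hc2 hc3 hc4 hyw hwx' hwz' ⊢
        omega
  have hde : e = rot90 d ∨ d = rot90 e := by
    obtain ⟨a, b⟩ := y
    obtain ⟨m, n⟩ := s
    rcases hd with rfl | rfl | rfl | rfl <;> rcases he with rfl | rfl | rfl | rfl <;>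
    first
      | exact absurd rfl hxz
      | exact Or.inl rfl
      | exact Or.inr rfl
      | simp only [IsCorner, Prod.mk_add_mk] at hc1 hc2 hc3
        omega
  rcases hde with rfl | rfl
  · exact ⟨d, hd, ⟨s, hs, hc3, hw ▸ hc4⟩, hw, Or.inl ⟨rfl, rfl⟩⟩
  · rw [add_right_comm] at hw
    exact ⟨e, he, ⟨s, hs, hc3, hw ▸ hc4⟩, hw, Or.inr ⟨rfl, rfl⟩⟩

end Steps

/-! ## Patterns and their holonomy -/

section Pattern

variable {S : Set (ℤ × ℤ)} {r R : ℤ × ℤ → ℝ}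

/-- The signed radius of the circle of `v` that passes through the touching point in the
direction `d`. -/
def stepRadius (r R : ℤ × ℤ → ℝ) (v d : ℤ × ℤ) : ℝ := if d.2 = 0 then r v else R v

lemma stepRadius_neg (r R : ℤ × ℤ → ℝ) (v d : ℤ × ℤ) :
    stepRadius r R v (-d) = stepRadius r R v d := by
  simp [stepRadius]

/-- The angle at the center of `v` from the touching point in the direction `d` to that in the
direction `rot90 d`. -/
def cornerAngle (r R : ℤ × ℤ → ℝ) (v d : ℤ × ℤ) : Circle :=
  kiteAngle (stepRadius r R v d) (stepRadius r R (v + d + rot90 d) (-rot90 d))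
    (stepRadius r R v (rot90 d)) (stepRadius r R (v + d + rot90 d) (-d))

lemma cornerAngle_opposite (r R : ℤ × ℤ → ℝ) (v d : ℤ × ℤ) :
    cornerAngle r R (v + d + rot90 d) (-d) =
      kiteAngle (stepRadius r R (v + d + rot90 d) (-d)) (stepRadius r R v (rot90 d))
        (stepRadius r R (v + d + rot90 d) (-rot90 d)) (stepRadius r R v d) := by
  rw [cornerAngle, rot90_neg, neg_neg, neg_neg,
    show v + d + rot90 d + -d + -rot90 d = v by abel]

/-- The four clauses become one that is uniform in the direction `d` from the ring to the touching
point: a quarter turn of `d` multiplies the normal by `i`. All local arguments can then treat the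
four squares at a vertex alike. -/
lemma exists_touch_iff {k ℓ : ℤ × ℤ → ℍ} {x : ℤ × ℤ} :
    (∃ u : ℂ, ‖u‖ = 1 ∧
      (∀ v, v = (x.1 - 1, x.2) → Edge S x v → HasNormal (k v) (r v) (ℓ x) u) ∧
      (∀ v, v = (x.1 + 1, x.2) → Edge S x v → HasNormal (k v) (r v) (ℓ x) (-u)) ∧
      (∀ v, v = (x.1, x.2 - 1) → Edge S x v → HasNormal (k v) (R v) (ℓ x) (Complex.I * u)) ∧
      (∀ v, v = (x.1, x.2 + 1) → Edge S x v → HasNormal (k v) (R v) (ℓ x) (-(Complex.I * u)))) ↔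
    ∃ u : Circle, ∀ d, IsUnitStep d → Edge S x (x - d) →
      HasNormal (k (x - d)) (stepRadius r R (x - d) d) (ℓ x) (stepCircle d * u : Circle) := by
  obtain ⟨a, b⟩ := x
  constructor
  · rintro ⟨u, hu, h1, h2, h3, h4⟩
    refine ⟨⟨u, mem_sphere_zero_iff_norm.2 hu⟩, ?_⟩
    obtain ⟨e1, e2, e3, e4⟩ := coe_stepCircle_mul u
    rintro d (rfl | rfl | rfl | rfl) hd
    · exact (congrArg (HasNormal _ _ _) e1).mpr (h1 _ (by simp) hd)
    · exact (congrArg (HasNormal _ _ _) e2).mpr (h3 _ (by simp) hd)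
    · exact (congrArg (HasNormal _ _ _) e3).mpr (h2 _ (by simp) hd)
    · exact (congrArg (HasNormal _ _ _) e4).mpr (h4 _ (by simp) hd)
  · rintro ⟨u, h⟩
    obtain ⟨e1, e2, e3, e4⟩ := coe_stepCircle_mul u
    refine ⟨u, Circle.norm_coe u, ?_, ?_, ?_, ?_⟩
    · rintro v hv hd
      obtain rfl : v = (a, b) - (1, 0) := by simp [hv]
      exact e1 ▸ h (1, 0) (by simp [IsUnitStep]) hd
    · rintro v hv hd
      obtain rfl : v = (a, b) - (-1, 0) := by simp [hv]
      exact e3 ▸ h (-1, 0) (by simp [IsUnitStep]) hd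
    · rintro v hv hd
      obtain rfl : v = (a, b) - (0, 1) := by simp [hv]
      exact e2 ▸ h (0, 1) (by simp [IsUnitStep]) hd
    · rintro v hv hd
      obtain rfl : v = (a, b) - (0, -1) := by simp [hv]
      exact e4 ▸ h (0, -1) (by simp [IsUnitStep]) hd

lemma HasNormal.advance_fst {k p : ℍ} {t : ℝ} {u : Circle} (h : HasNormal k t p u) :
    (advance t (p, u)).1 = k :=
  advance_fst_eq (hasNormal_iff.1 h).2

lemma Edge.mem_pointVertices {x y : ℤ × ℤ} (h : Edge S x y) (hx : Odd (x.1 + x.2)) :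
    x ∈ pointVertices S := by
  obtain ⟨s, hs, h1, -⟩ := h
  exact ⟨⟨s, hs, h1⟩, hx⟩

/-- The hypotenuses of the right triangles in a pattern are longer than `0`. -/
lemma one_lt_cosh_mul_cosh {v w d e : ℤ × ℤ} (hd : IsUnitStep d) (hv : 0 < R v) (hw : 0 < R w)
    (he : e = -rot90 d) :
    1 < Real.cosh (stepRadius r R v d) * Real.cosh (stepRadius r R w e) := by
  have h1 : ∀ {x y : ℝ}, 1 < x → 1 ≤ y → 1 < x * y := fun hx hy => by nlinarith
  have hv' := Real.one_lt_cosh.2 hv.ne'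
  have hw' := Real.one_lt_cosh.2 hw.ne'
  -- Exactly one of the two radii is an outer one and makes the product exceed 1; the inner radius
  -- may be 0.
  rcases hd with rfl | rfl | rfl | rfl <;> simp only [he, stepRadius, rot90] <;> norm_num
  · rw [mul_comm]; exact h1 hw' (Real.one_le_cosh _)
  · exact h1 hv' (Real.one_le_cosh _)
  · rw [mul_comm]; exact h1 hw' (Real.one_le_cosh _)
  · exact h1 hv' (Real.one_le_cosh _)

lemma IsGeneralizedPattern.prod_cornerAngle {k ℓ : ℤ × ℤ → ℍ}
    (h : IsGeneralizedPattern S r R k ℓ) (hR : ∀ v ∈ ringVertices S, 0 < R v) {v : ℤ × ℤ}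
    (hv : IsInternal S v) :
    cornerAngle r R v (1, 0) * cornerAngle r R v (0, 1) * cornerAngle r R v (-1, 0) *
      cornerAngle r R v (0, -1) = 1 := by
  have ht := fun x hx => exists_touch_iff.1 (h.touch x hx)
  choose! u hu using ht
  rw [isInternal_iff] at hv
  obtain ⟨he, h1, h2, h3, h4⟩ := hv
  have hvr : v ∈ ringVertices S := by
    obtain ⟨s, hs, h1, -⟩ := h1
    exact ⟨⟨s, hs, h1⟩, he⟩
  -- The normal at the touching point in direction `d`, transported to the center of `v`. Each
  -- square turns it by the corner angle, and after four squares it is back.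
  let n : ℤ × ℤ → Circle := fun d =>
    (advance (stepRadius r R v d) (ℓ (v + d), stepCircle d * u (v + d))).2
  have key : ∀ d, IsUnitStep d → HasSquare S v d → n (rot90 d) = cornerAngle r R v d * n d := by
    intro d hd hs
    obtain ⟨e1, e2, e3, e4⟩ := hs.edges hd
    have hx := e1.mem_pointVertices (odd_add_step hd he)
    have hy := e2.mem_pointVertices (odd_add_step hd.rot90 he)
    have f1 := hu _ hx d hd (by rwa [add_sub_cancel_right])
    have f2 := hu _ hy (rot90 d) hd.rot90 (by rwa [add_sub_cancel_right])
    have f3 := hu _ hx (-rot90 d) hd.rot90.neg (by rwa [sub_neg_eq_add])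
    have f4 := hu _ hy (-d) hd.neg (by rwa [sub_neg_eq_add, add_right_comm])
    rw [add_sub_cancel_right] at f1 f2
    rw [sub_neg_eq_add] at f3 f4
    rw [add_right_comm] at f4
    rw [stepCircle_neg_rot90 hd, mul_assoc] at f3
    rw [stepCircle_neg hd, ← stepCircle_rot90 hd, mul_assoc] at f4
    exact (kite_closed (f1.advance_fst.trans f2.advance_fst.symm)
      (f3.advance_fst.trans f4.advance_fst.symm)
      (one_lt_cosh_mul_cosh hd (hR _ hvr) (hR _ (hs.neighbors hd he).mem_right) rfl)).2
  have k1 := key (1, 0) (by simp [IsUnitStep]) h1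
  have k2 := key (0, 1) (by simp [IsUnitStep]) h2
  have k3 := key (-1, 0) (by simp [IsUnitStep]) h3
  have k4 := key (0, -1) (by simp [IsUnitStep]) h4
  simp only [rot90, neg_zero, neg_neg] at k1 k2 k3 k4
  rw [k3, k2, k1] at k4
  refine mul_right_cancel (b := n (1, 0)) ?_
  rw [one_mul]
  refine Eq.trans ?_ k4.symm
  simp only [mul_assoc, mul_comm, mul_left_comm]

/-- If one of the four relations is absent, the cycle is cut there and solved along the remaining
chain; only the full cycle has an obstruction. -/
lemma exists_cyclic_phases {G : Type*} [CommGroup G] (P₀ P₁ P₂ P₃ : Prop) (e₀ e₁ e₂ e₃ : G)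
    (h : P₀ → P₁ → P₂ → P₃ → e₀ * e₁ * e₂ * e₃ = 1) : ∃ f₀ f₁ f₂ f₃ : G,
      (P₀ → f₁ = e₀ * f₀) ∧ (P₁ → f₂ = e₁ * f₁) ∧ (P₂ → f₃ = e₂ * f₂) ∧ (P₃ → f₀ = e₃ * f₃) := by
  by_cases h0 : P₀
  swap
  · exact ⟨e₃ * (e₂ * e₁), 1, e₁, e₂ * e₁, by tauto, by simp, by simp, by simp⟩
  by_cases h1 : P₁
  swap
  · exact ⟨e₃ * e₂, e₀ * (e₃ * e₂), 1, e₂, by simp, by tauto, by simp, by simp⟩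
  by_cases h2 : P₂
  swap
  · exact ⟨e₃, e₀ * e₃, e₁ * (e₀ * e₃), 1, by simp, by simp, by tauto, by simp⟩
  refine ⟨1, e₀, e₁ * e₀, e₂ * (e₁ * e₀), by simp, by simp, by simp, fun h3 => ?_⟩
  rw [← h h0 h1 h2 h3]
  simp only [mul_comm, mul_left_comm]

/-- `φ d` records, against an arbitrary reference direction at the center, the direction belonging
to the touching point at `v + d`. Boundary vertices impose no closing condition. -/
lemma exists_phases {v : ℤ × ℤ} (he : Even (v.1 + v.2)) (h : IsInternal S v →
      cornerAngle r R v (1, 0) * cornerAngle r R v (0, 1) * cornerAngle r R v (-1, 0) *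
      cornerAngle r R v (0, -1) = 1) :
    ∃ φ : ℤ × ℤ → Circle, ∀ d, IsUnitStep d → HasSquare S v d →
      φ (rot90 d) = cornerAngle r R v d * φ d := by
  obtain ⟨f₀, f₁, f₂, f₃, h0, h1, h2, h3⟩ := exists_cyclic_phases (HasSquare S v (1, 0))
    (HasSquare S v (0, 1)) (HasSquare S v (-1, 0)) (HasSquare S v (0, -1)) _ _ _ _
    fun h0 h1 h2 h3 => h (isInternal_iff.2 ⟨he, h0, h1, h2, h3⟩)
  refine ⟨fun d => if d = (1, 0) then f₀ else if d = (0, 1) then f₁ else if d = (-1, 0) then f₂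
    else f₃, ?_⟩
  rintro d (rfl | rfl | rfl | rfl) hs
  · simpa [rot90] using h0 hs
  · simpa [rot90] using h1 hs
  · simpa [rot90] using h2 hs
  · simpa [rot90] using h3 hs

/-- The change of frame from an odd vertex `x` to an adjacent even vertex `v`. -/
def edgeMap (r R : ℤ × ℤ → ℝ) (φ : ℤ × ℤ → ℤ × ℤ → Circle) (x v : ℤ × ℤ) : Equiv.Perm Frame :=
  rotate (φ v (x - v))⁻¹ * advancePerm (stepRadius r R v (x - v)) * rotate (stepCircle (x - v))

lemma edgeMap_add_apply (r R : ℤ × ℤ → ℝ) (φ : ℤ × ℤ → ℤ × ℤ → Circle) (v d : ℤ × ℤ) (F : Frame) :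
    edgeMap r R φ (v + d) v F =
      rotate (φ v d)⁻¹ (advance (stepRadius r R v d) (rotate (stepCircle d) F)) := by
  rw [edgeMap, add_sub_cancel_left]
  rfl

/-- The passage from one touching point of a kite to the other is the same through either center. By
the choice of the phases, the rotation at `v` is its corner angle; `kite_close` then provides the
passage through the opposite center, with its own corner angle. -/
lemma edgeMap_square {φ : ℤ × ℤ → ℤ × ℤ → Circle} {v d : ℤ × ℤ} (hd : IsUnitStep d)
    (hφ : φ v (rot90 d) = cornerAngle r R v d * φ v d)
    (hφ' : φ (v + d + rot90 d) (-rot90 d) =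
      cornerAngle r R (v + d + rot90 d) (-d) * φ (v + d + rot90 d) (-d))
    (hD : 1 < Real.cosh (stepRadius r R v d) *
      Real.cosh (stepRadius r R (v + d + rot90 d) (-rot90 d)))
    (hD' : Real.cosh (stepRadius r R v d) *
        Real.cosh (stepRadius r R (v + d + rot90 d) (-rot90 d)) =
      Real.cosh (stepRadius r R v (rot90 d)) * Real.cosh (stepRadius r R (v + d + rot90 d) (-d))) :
    (edgeMap r R φ (v + rot90 d) v)⁻¹ * edgeMap r R φ (v + d) v =
      (edgeMap r R φ (v + rot90 d) (v + d + rot90 d))⁻¹ *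
        edgeMap r R φ (v + d) (v + d + rot90 d) := by
  rw [eq_inv_mul_iff_mul_eq]
  ext1 F
  set w := v + d + rot90 d with hw
  have hx : v + d = w + -rot90 d := by rw [hw]; abel
  have hy : v + rot90 d = w + -d := by rw [hw]; abel
  rw [Equiv.Perm.mul_apply, Equiv.Perm.mul_apply]
  obtain ⟨G, hG⟩ := (edgeMap r R φ (v + rot90 d) v).surjective (edgeMap r R φ (v + d) v F)
  rw [← hG, Equiv.Perm.inv_def, Equiv.symm_apply_apply, hx, hy, edgeMap_add_apply, edgeMap_add_apply]
  rw [edgeMap_add_apply, edgeMap_add_apply] at hG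
  have hG' : advance (stepRadius r R v (rot90 d)) (rotate (stepCircle (rot90 d)) G) =
      rotate (cornerAngle r R v d) (advance (stepRadius r R v d) (rotate (stepCircle d) F)) := by
    have := congrArg (rotate (φ v (rot90 d))) hG
    rwa [rotate_rotate, rotate_rotate, mul_inv_cancel, rotate_one, hφ, mul_inv_cancel_right] at this
  have h := kite_close hG' hD hD'
  rw [← cornerAngle_opposite, ← hw, rotate_rotate, rotate_rotate, ← stepCircle_neg_rot90 hd,
    stepCircle_rot90 hd, ← stepCircle_neg hd] at h
  rw [h, rotate_rotate, hφ', mul_inv_rev, inv_mul_cancel_right]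

/-- Orthogonality is implied by the touching condition: neighbors `v`, `w` share two touching
points, and at the one lying vertically from `v` the outer circle of `v` and the inner circle of `w`
have perpendicular normals. -/
lemma IsGeneralizedPattern.of_touch {k ℓ : ℤ × ℤ → ℍ}
    (h : ∀ x ∈ pointVertices S, ∃ u : Circle, ∀ d, IsUnitStep d → Edge S x (x - d) →
      HasNormal (k (x - d)) (stepRadius r R (x - d) d) (ℓ x) (stepCircle d * u : Circle)) :
    IsGeneralizedPattern S r R k ℓ where
  touch x hx := exists_touch_iff.2 (h x hx)
  orthogonal v w hvw := by
    obtain ⟨d, hd, hs, rfl⟩ := hvw.exists_step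
    have he := hvw.2.1
    obtain ⟨e1, e2, e3, e4⟩ := hs.edges hd
    obtain ⟨u, hu⟩ := h _ (e1.mem_pointVertices (odd_add_step hd he))
    obtain ⟨u', hu'⟩ := h _ (e2.mem_pointVertices (odd_add_step hd.rot90 he))
    have f1 := hu d hd (by rwa [add_sub_cancel_right])
    have f2 := hu' (rot90 d) hd.rot90 (by rwa [add_sub_cancel_right])
    have f3 := hu (-rot90 d) hd.rot90.neg (by rwa [sub_neg_eq_add])
    have f4 := hu' (-d) hd.neg (by rwa [sub_neg_eq_add, add_right_comm])
    rw [add_sub_cancel_right] at f1 f2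
    rw [sub_neg_eq_add] at f3 f4
    rw [add_right_comm] at f4
    rw [stepCircle_neg_rot90 hd, mul_assoc] at f3
    rw [stepCircle_neg hd, ← stepCircle_rot90 hd, mul_assoc] at f4
    have hre : ∀ z : Circle, ((z : ℂ) * (starRingEnd ℂ) (circleI⁻¹ * z : Circle)).re = 0 ∧
        ((z : ℂ) * (starRingEnd ℂ) (circleI * z : Circle)).re = 0 := fun z => by
      rw [Circle.coe_mul, Circle.coe_mul, coe_circleI_inv, coe_circleI]
      constructor <;> simp <;> ring
    rw [stepRadius_neg] at f3 f4
    by_cases h0 : d.2 = 0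
    · have h1 : ¬(rot90 d).2 = 0 := by
        rcases hd with rfl | rfl | rfl | rfl <;> simp [rot90] at h0 ⊢
      rw [stepRadius, if_neg h1] at f2
      rw [stepRadius, if_pos h0] at f4
      exact ⟨_, _, _, f2, f4, (hre _).2⟩
    · have h1 : (rot90 d).2 = 0 := by
        rcases hd with rfl | rfl | rfl | rfl <;> simp [rot90] at h0 ⊢
      rw [stepRadius, if_neg h0] at f1
      rw [stepRadius, if_pos h1] at f3
      exact ⟨_, _, _, f1, f3, (hre _).1⟩

/-- The angle condition supplies phases at the even vertices. At the odd vertices nothing has to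
close, since `stepCircle` prescribes right angles there. -/
lemma formGeneralizedPattern_of_prod_cornerAngle (hS : IsSimplyConnected S)
    (hR : ∀ v ∈ ringVertices S, 0 < R v)
    (hD : ∀ v w, Neighbors S v w → Real.cosh (r v) * Real.cosh (R w) =
      Real.cosh (R v) * Real.cosh (r w))
    (hprod : ∀ v, IsInternal S v → cornerAngle r R v (1, 0) * cornerAngle r R v (0, 1) *
      cornerAngle r R v (-1, 0) * cornerAngle r R v (0, -1) = 1) :
    FormGeneralizedPattern S r R := by
  have hφ : ∀ v : ℤ × ℤ, ∃ φ : ℤ × ℤ → Circle, Even (v.1 + v.2) → ∀ d, IsUnitStep d →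
      HasSquare S v d → φ (rot90 d) = cornerAngle r R v d * φ d := fun v => by
    by_cases he : Even (v.1 + v.2)
    · obtain ⟨φ, h⟩ := exists_phases he (hprod v)
      exact ⟨φ, fun _ => h⟩
    · exact ⟨1, fun h => absurd h he⟩
  choose φ hφ using hφ
  let T := edgeMap r R φ
  have hT : ∀ v d, Even (v.1 + v.2) → IsUnitStep d → HasSquare S v d →
      (T (v + rot90 d) v)⁻¹ * T (v + d) v =
        (T (v + rot90 d) (v + d + rot90 d))⁻¹ * T (v + d) (v + d + rot90 d) := by
    intro v d he hd hs
    have hn := hs.neighbors hd he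
    refine edgeMap_square hd (hφ v he d hd hs) (hφ _ hn.2.2.1 (-d) hd.neg hs.opposite)
      (one_lt_cosh_mul_cosh hd (hR _ hn.symm.mem_right) (hR _ hn.mem_right) rfl) ?_
    have h1 := hD _ _ hn
    rw [stepRadius_neg, stepRadius_neg]
    rcases hd with rfl | rfl | rfl | rfl <;> simp only [stepRadius, rot90] at h1 ⊢ <;> simp <;>
      first
      | exact h1
      | exact h1.symm
  -- `T` leads from odd to even vertices; the opposite direction uses the inverse.
  let H : ℤ × ℤ → ℤ × ℤ → Equiv.Perm Frame := fun x y =>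
    if Odd (x.1 + x.2) then T x y else (T y x)⁻¹
  have Hodd : ∀ {x y : ℤ × ℤ}, Odd (x.1 + x.2) → H x y = T x y := fun h => if_pos h
  have Heven : ∀ {x y : ℤ × ℤ}, Even (x.1 + x.2) → H x y = (T y x)⁻¹ := fun h =>
    if_neg (Int.not_odd_iff_even.2 h)
  have hparity : ∀ {x y}, Edge S x y → Even (y.1 + y.2) → Odd (x.1 + x.2) := fun h he => by
    obtain ⟨d, hd, rfl⟩ := h.exists_step
    exact odd_add_step hd he
  have hback : ∀ x y, Edge S x y → H y x * H x y = 1 := by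
    intro x y hxy
    rcases Int.even_or_odd (y.1 + y.2) with hy | hy
    · rw [Hodd (hparity hxy hy), Heven hy, inv_mul_cancel]
    · rcases Int.even_or_odd (x.1 + x.2) with hx | hx
      · rw [Hodd hy, Heven hx, mul_inv_cancel]
      · exfalso
        obtain ⟨d, hd, rfl⟩ := hxy.exists_step
        rw [Int.odd_iff] at hx hy
        rcases hd with rfl | rfl | rfl | rfl <;> simp at hx <;> omega
  have hsq : ∀ s x y z w, s ∈ S → IsSide s x y → IsSide s y z → IsSide s z w → IsSide s w x →
      x ≠ z → y ≠ w → H y z * H x y = H w z * H x w := by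
    have main : ∀ s x y z w, s ∈ S → IsSide s x y → IsSide s y z → IsSide s z w → IsSide s w x →
        x ≠ z → y ≠ w → Even (y.1 + y.2) →
        (T z y)⁻¹ * T x y = (T z w)⁻¹ * T x w ∧ Even (w.1 + w.2) := by
      intro s x y z w hs hxy hyz hzw hwx hxz hyw he
      obtain ⟨d, hd, hsq, rfl, ⟨rfl, rfl⟩ | ⟨rfl, rfl⟩⟩ :=
        exists_step_of_sides hs hxy hyz hzw hwx hxz hyw
      · exact ⟨hT y d he hd hsq, (hsq.neighbors hd he).2.2.1⟩
      · refine ⟨?_, (hsq.neighbors hd he).2.2.1⟩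
        have := congrArg (·⁻¹) (hT y d he hd hsq)
        simpa using this
    intro s x y z w hs hxy hyz hzw hwx hxz hyw
    have exy : Edge S x y := ⟨s, hs, hxy⟩
    have eyz : Edge S y z := ⟨s, hs, hyz⟩
    have ezw : Edge S z w := ⟨s, hs, hzw⟩
    rcases Int.even_or_odd (y.1 + y.2) with hy | hy
    · obtain ⟨h, hw⟩ := main s x y z w hs hxy hyz hzw hwx hxz hyw hy
      have hx := hparity exy hy
      rw [Heven hy, Hodd hx, Heven hw, Hodd hx, h]
    · have hz : Even (z.1 + z.2) := by
        by_contra hz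
        rw [Int.not_even_iff_odd] at hz
        have := hback y z eyz
        obtain ⟨d, hd, rfl⟩ := eyz.exists_step
        rw [Int.odd_iff] at hy hz
        rcases hd with rfl | rfl | rfl | rfl <;> simp at hy <;> omega
      have hw := hparity ezw.symm hz
      -- With odd middle vertices, the square is read starting from `y`, and the resulting relation
      -- is rearranged.
      obtain ⟨h, hx⟩ := main s y z w x hs hyz hzw hwx hxy hyw hxz.symm hz
      rw [Hodd hy, Heven hx, Hodd hw, Heven hx]
      rw [inv_mul_eq_iff_eq_mul] at h
      rw [h]
      group
  obtain ⟨g, hg⟩ := exists_developing hback hsq hS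
  -- Any initial frame would do.
  let F₀ : Frame := (UpperHalfPlane.I, 1)
  refine ⟨fun v => (g v F₀).1, fun x => (g x F₀).1, IsGeneralizedPattern.of_touch fun x hx => ?_⟩
  refine ⟨(g x F₀).2, fun d hd hxd => ?_⟩
  have h1 := hg x (x - d) hxd
  rw [Hodd hx.2] at h1
  have h2 : g (x - d) F₀ = T (x - d + d) (x - d) (g x F₀) := by
    rw [sub_add_cancel, h1, Equiv.Perm.mul_apply]
  have h3 := hasNormal_advance (stepRadius r R (x - d) d) (rotate (stepCircle d) (g x F₀))
  rw [h2, edgeMap_add_apply]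
  exact h3

end Pattern

/-! ## Uniformization of rings -/

section Uniformization

variable {q γ r R : ℝ}

lemma tanh_eq_sqrt {x : ℝ} (hx : 0 < x) : Real.tanh x = Real.sqrt (1 - (1 / Real.cosh x) ^ 2) := by
  have hc := Real.cosh_pos x
  have hs := Real.sinh_pos_iff.2 hx
  rw [eq_comm, Real.sqrt_eq_iff_mul_self_eq_of_pos]
  · rw [Real.tanh_eq_sinh_div_cosh]
    field_simp
    linarith [Real.cosh_sq x]
  · rw [Real.tanh_eq_sinh_div_cosh]
    positivity

lemma sqrt_one_sub_tanh_sq (x : ℝ) : Real.sqrt (1 - Real.tanh x ^ 2) = 1 / Real.cosh x := by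
  have hc := Real.cosh_pos x
  rw [Real.sqrt_eq_iff_mul_self_eq_of_pos (by positivity), Real.tanh_eq_sinh_div_cosh]
  field_simp
  linarith [Real.cosh_sq x]

lemma exists_uniformizedByGamma (h0 : 0 < q) (h1 : q ≤ 1) (hring : IsRing r R)
    (hq : Real.cosh r = q * Real.cosh R) :
    ∃ γ, InInterval q γ ∧ UniformizedByGamma q γ r R := by
  obtain ⟨hR, hr1, hr2⟩ := hring
  have hcr := Real.cosh_pos r
  have hcR := Real.cosh_pos R
  obtain ⟨γ, hγ, hs, hc⟩ : ∃ γ, InInterval q γ ∧ snR q γ = 1 / Real.cosh r ∧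
      cnR q γ = Real.tanh r := by
    rcases h1.lt_or_eq with h1 | rfl
    · have hm := strictMono_ellF h0.le h1
      -- The amplitude of `γ` is to be `arccos (tanh r)`, which lies in `[0, π]`, the image of `[0,
      -- 2K]`.
      refine ⟨ellF q (Real.arccos (Real.tanh r)), ⟨?_, fun _ => ?_⟩, ?_, ?_⟩
      · rw [← ellF_zero (q := q)]
        exact hm.monotone (Real.arccos_nonneg _)
      · rw [← ellF_pi h0.le h1]
        exact hm.monotone (Real.arccos_le_pi _)
      · rw [snR, am_ellF h0.le h1, Real.sin_arccos, sqrt_one_sub_tanh_sq]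
      · rw [cnR, am_ellF h0.le h1, Real.cos_arccos (Real.neg_one_lt_tanh r).le
          (Real.tanh_lt_one r).le]
    · obtain rfl : r = R := by
        rw [one_mul] at hq
        have habs : |r| = |R| :=
          le_antisymm (Real.cosh_le_cosh.1 hq.le) (Real.cosh_le_cosh.1 hq.ge)
        rcases abs_eq_abs.1 habs with hq | hq
        · exact hq
        · linarith
      have hlt : 1 / Real.cosh r < 1 := by
        rw [div_lt_one hcr]
        exact Real.one_lt_cosh.2 hR.ne'
      have hpos : 0 < 1 / Real.cosh r := by positivity
      have ht : Real.tanh (Real.artanh (1 / Real.cosh r)) = 1 / Real.cosh r :=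
        Real.tanh_artanh ⟨by linarith, hlt⟩
      refine ⟨Real.artanh (1 / Real.cosh r), ⟨(Real.artanh_pos ⟨hpos, hlt⟩).le,
        fun h => absurd h (lt_irrefl _)⟩, by rw [snR_one, ht], ?_⟩
      rw [cnR, am, if_neg (lt_irrefl _), ht, Real.cos_arcsin, tanh_eq_sqrt hR]
  refine ⟨γ, hγ, ?_, ?_, ?_⟩
  · rw [hs, hq]
    field_simp
  · rw [dnR, hs, tanh_eq_sqrt hR, hq]
    congr 1
    field_simp
  · rw [hs, hc, Real.tanh_eq_sinh_div_cosh]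
    field_simp

lemma UniformizedByGamma.snR_pos (h0 : 0 < q) (h : UniformizedByGamma q γ r R) :
    0 < snR q γ := by
  have h1 := Real.cosh_pos R
  rw [h.1, one_div_pos] at h1
  exact pos_of_mul_pos_right h1 h0.le

lemma UniformizedByGamma.cosh_inner (h0 : 0 < q) (h : UniformizedByGamma q γ r R) :
    Real.cosh r = 1 / snR q γ := by
  have hs := h.snR_pos h0
  refine (sq_eq_sq₀ (Real.cosh_pos r).le (by positivity)).1 ?_
  rw [Real.cosh_sq, h.2.2]
  field_simp
  linarith [snR_sq_add_cnR_sq q γ]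

lemma UniformizedByGamma.sinh_outer (h : UniformizedByGamma q γ r R) :
    Real.sinh R = dnR q γ / (q * snR q γ) := by
  rw [← h.2.1, Real.tanh_eq_sinh_div_cosh, div_div, ← div_div, div_eq_mul_one_div _ (q * _),
    ← h.1, div_mul_cancel₀ _ (Real.cosh_pos R).ne']

lemma UniformizedByGamma.cosh_inner_eq_mul (h0 : 0 < q) (h : UniformizedByGamma q γ r R) :
    Real.cosh r = q * Real.cosh R := by
  have hs := h.snR_pos h0
  rw [h.cosh_inner h0, h.1]
  field_simp

lemma uniformizedByBeta_iff (h0 : 0 < q) (h1 : q ≤ 1) :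
    UniformizedByBeta q (betaOf q γ) r R ↔ UniformizedByGamma q γ r R := by
  have hre : (betaOf q γ).re = γ := by simp [betaOf]
  have him : (betaOf q γ).im = quarterK' q := by simp [betaOf]
  have hI := Complex.I_sq
  have e1 : sn q (betaOf q γ) = ((1 / (q * snR q γ) : ℝ) : ℂ) := by
    simp only [sn, jacobiDen, hre, him, snR_compl_quarterK' h0 h1, cnR_compl_quarterK' h0 h1,
      dnR_compl_quarterK' h0 h1]
    -- At a pole both sides are divisions by zero with value 0. Such `γ` drop out later because
    -- `cosh R` is positive.
    by_cases hs : snR q γ = 0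
    · simp [hs]
    · have hs' : (snR q γ : ℂ) ≠ 0 := by exact_mod_cast hs
      have hq : (q : ℂ) ≠ 0 := by exact_mod_cast h0.ne'
      push_cast
      field_simp
      ring
  have e2 : Complex.I * cn q (betaOf q γ) = ((dnR q γ / (q * snR q γ) : ℝ) : ℂ) := by
    simp only [cn, jacobiDen, hre, him, snR_compl_quarterK' h0 h1, cnR_compl_quarterK' h0 h1,
      dnR_compl_quarterK' h0 h1]
    by_cases hs : snR q γ = 0
    · simp [hs]
    · have hs' : (snR q γ : ℂ) ≠ 0 := by exact_mod_cast hs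
      have hq : (q : ℂ) ≠ 0 := by exact_mod_cast h0.ne'
      push_cast
      field_simp
      linear_combination (-(q : ℂ) ^ 2 * snR q γ ^ 2 * dnR q γ) * hI
  have e3 : Complex.I * dn q (betaOf q γ) = ((cnR q γ / snR q γ : ℝ) : ℂ) := by
    simp only [dn, jacobiDen, hre, him, snR_compl_quarterK' h0 h1, cnR_compl_quarterK' h0 h1,
      dnR_compl_quarterK' h0 h1]
    by_cases hs : snR q γ = 0
    · simp [hs]
    · have hs' : (snR q γ : ℂ) ≠ 0 := by exact_mod_cast hs
      have hq : (q : ℂ) ≠ 0 := by exact_mod_cast h0.ne'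
      push_cast
      field_simp
      linear_combination (-(q : ℂ) ^ 2 * snR q γ ^ 2 * cnR q γ) * hI
  rw [UniformizedByBeta, e1, e2, e3, Complex.ofReal_inj, Complex.ofReal_inj, Complex.ofReal_inj]
  refine ⟨fun ⟨h1, h2, h3⟩ => ⟨h1, ?_, h3⟩, fun h => ⟨h.1, h.sinh_outer, h.2.2⟩⟩
  have hpos := Real.cosh_pos R
  rw [h1, one_div_pos] at hpos
  have hs := (pos_of_mul_pos_right hpos h0.le).ne'
  rw [Real.tanh_eq_sinh_div_cosh, h1, h2]
  field_simp

end Uniformization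

/-! ## The product equations -/

section Equations

variable {q : ℝ}

/-- Clearing the denominators `q sn γ sn γ'` turns the two complex numbers defining the kite angle
into the two phases of `phase_mul_gammaFactor`. -/
lemma kiteAngle_mul_gammaFactor (h0 : 0 < q) (h1 : q ≤ 1) {γ r R γ' r' R' : ℝ}
    (h : UniformizedByGamma q γ r R) (h' : UniformizedByGamma q γ' r' R') :
    (kiteAngle r R' R r' : ℂ) *
      (sn q (((γ : ℂ) - (γ' : ℂ) + Complex.I * (quarterK' q : ℂ)) / 2) /
        sn q (((γ : ℂ) + (γ' : ℂ) - Complex.I * (quarterK' q : ℂ)) / 2)) = -1 := by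
  have hs := h.snR_pos h0
  have hs' := h'.snR_pos h0
  have hD : Real.cosh r * Real.cosh R' = Real.cosh R * Real.cosh r' := by
    rw [h.cosh_inner_eq_mul h0, h'.cosh_inner_eq_mul h0]
    ring
  have hk := coe_kiteAngle_mul hD
  rw [h.cosh_inner h0, h.sinh_outer, h.2.2, h'.cosh_inner h0, h'.sinh_outer, h'.1,
    h'.2.2] at hk
  have hp := phase_mul_gammaFactor h0 h1 γ γ'
  rw [gammaFactor_eq_mul h0 h1]
  have hΔ : (1 : ℂ) - (q : ℂ) ^ 2 * snR q γ ^ 2 * snR q γ' ^ 2 ≠ 0 := by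
    exact_mod_cast (one_sub_mul_snR_sq_mul_snR_sq_pos h0.le h1 γ γ').ne'
  have hqc : (q : ℂ) ≠ 0 := by exact_mod_cast h0.ne'
  have hsc : (snR q γ : ℂ) ≠ 0 := by exact_mod_cast hs.ne'
  have hsc' : (snR q γ' : ℂ) ≠ 0 := by exact_mod_cast hs'.ne'
  push_cast at hk
  field_simp at hk
  apply mul_left_cancel₀ hΔ
  rw [mul_neg_one, ← hp, ← mul_assoc]
  congr 1
  linear_combination hk

lemma prod_diagonals {M : Type*} [CommMonoid M] (f : ℤ × ℤ → M) :
    ∏ d ∈ diagonals, f d = f (1, 1) * f (-1, 1) * f (-1, -1) * f (1, -1) := by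
  rw [diagonals, Finset.prod_product, Finset.prod_pair (by norm_num), Finset.prod_pair (by norm_num),
    Finset.prod_pair (by norm_num)]
  simp only [mul_assoc, mul_comm, mul_left_comm]

lemma betaEquation_iff (h0 : 0 < q) (h1 : q ≤ 1) (γ : ℤ × ℤ → ℝ) (v : ℤ × ℤ) :
    BetaEquation q (fun w => betaOf q (γ w)) v ↔ GammaEquation q γ v := by
  simp only [BetaEquation, GammaEquation, betaFactor_eq_gammaFactor h0 h1]

variable {S : Set (ℤ × ℤ)} {r R γ : ℤ × ℤ → ℝ}

/-- Each factor is minus the inverse of a corner angle, and the four signs cancel. At the two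
corners that begin with a vertical step the outer radius comes first, hence `kiteAngle_swap`. -/
lemma gammaEquation_iff (h0 : 0 < q) (h1 : q ≤ 1)
    (h : ∀ v ∈ ringVertices S, UniformizedByGamma q (γ v) (r v) (R v)) {v : ℤ × ℤ}
    (hv : IsInternal S v) :
    GammaEquation q γ v ↔ cornerAngle r R v (1, 0) * cornerAngle r R v (0, 1) *
      cornerAngle r R v (-1, 0) * cornerAngle r R v (0, -1) = 1 := by
  rw [isInternal_iff] at hv
  obtain ⟨he, s1, s2, s3, s4⟩ := hv
  have n1 := s1.neighbors (by simp [IsUnitStep]) he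
  have n2 := s2.neighbors (by simp [IsUnitStep]) he
  have n3 := s3.neighbors (by simp [IsUnitStep]) he
  have n4 := s4.neighbors (by simp [IsUnitStep]) he
  have hv := h v n1.symm.mem_right
  have f1 := kiteAngle_mul_gammaFactor h0 h1 hv (h _ n1.mem_right)
  have f2 := kiteAngle_mul_gammaFactor h0 h1 hv (h _ n2.mem_right)
  have f3 := kiteAngle_mul_gammaFactor h0 h1 hv (h _ n3.mem_right)
  have f4 := kiteAngle_mul_gammaFactor h0 h1 hv (h _ n4.mem_right)
  rw [kiteAngle_swap] at f2 f4
  have c1 : cornerAngle r R v (1, 0) = kiteAngle (r v) (R (v + (1, 0) + rot90 (1, 0)))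
    (R v) (r (v + (1, 0) + rot90 (1, 0))) := by simp [cornerAngle, stepRadius, rot90]
  have c2 : cornerAngle r R v (0, 1) = kiteAngle (R v) (r (v + (0, 1) + rot90 (0, 1)))
    (r v) (R (v + (0, 1) + rot90 (0, 1))) := by simp [cornerAngle, stepRadius, rot90]
  have c3 : cornerAngle r R v (-1, 0) = kiteAngle (r v) (R (v + (-1, 0) + rot90 (-1, 0)))
    (R v) (r (v + (-1, 0) + rot90 (-1, 0))) := by simp [cornerAngle, stepRadius, rot90]
  have c4 : cornerAngle r R v (0, -1) = kiteAngle (R v) (r (v + (0, -1) + rot90 (0, -1)))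
    (r v) (R (v + (0, -1) + rot90 (0, -1))) := by simp [cornerAngle, stepRadius, rot90]
  rw [← c1] at f1
  rw [← c2] at f2
  rw [← c3] at f3
  rw [← c4] at f4
  simp only [rot90, add_assoc, Prod.mk_add_mk, neg_zero, neg_neg, add_zero, zero_add] at f1 f2 f3 f4
  rw [GammaEquation, prod_diagonals, ← Circle.coe_inj, Circle.coe_mul, Circle.coe_mul,
    Circle.coe_mul, Circle.coe_one]
  generalize (cornerAngle r R v (1, 0) : ℂ) = a₁ at *
  generalize (cornerAngle r R v (0, 1) : ℂ) = a₂ at *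
  generalize (cornerAngle r R v (-1, 0) : ℂ) = a₃ at *
  generalize (cornerAngle r R v (0, -1) : ℂ) = a₄ at *
  have hprod : ∀ {b₁ b₂ b₃ b₄ : ℂ}, a₁ * b₁ = -1 → a₂ * b₂ = -1 → a₃ * b₃ = -1 → a₄ * b₄ = -1 →
      (b₁ * b₂ * b₃ * b₄ = 1 ↔ a₁ * a₂ * a₃ * a₄ = 1) := by
    intro b₁ b₂ b₃ b₄ g1 g2 g3 g4
    have : (a₁ * a₂ * a₃ * a₄) * (b₁ * b₂ * b₃ * b₄) = 1 := by
      calc _ = (a₁ * b₁) * (a₂ * b₂) * (a₃ * b₃) * (a₄ * b₄) := by ring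
        _ = 1 := by rw [g1, g2, g3, g4]; norm_num
    constructor <;> intro h
    · rwa [h, mul_one] at this
    · rwa [h, one_mul] at this
  exact hprod f1 f2 f3 f4

/-- Both sides are the hyperbolic cosine of the distance between the two centers, by the two
orthogonality conditions. -/
lemma IsGeneralizedPattern.cosh_mul_cosh {v w : ℤ × ℤ} {k ℓ : ℤ × ℤ → ℍ}
    (h : IsGeneralizedPattern S r R k ℓ) (hvw : Neighbors S v w) :
    Real.cosh (R v) * Real.cosh (r w) = Real.cosh (R w) * Real.cosh (r v) := by
  have h1 := (h.orthogonal v w hvw).normSq_toDisk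
  have h2 := (h.orthogonal w v hvw.symm).normSq_toDisk
  rw [Complex.normSq_eq_norm_sq, norm_toDisk] at h1 h2
  rw [dist_comm, h1] at h2
  exact eq_of_sub_one_div_add_one_eq (mul_pos (Real.cosh_pos _) (Real.cosh_pos _))
    (mul_pos (Real.cosh_pos _) (Real.cosh_pos _)) h2

lemma FormGeneralizedPattern.exists_modulus (hG : RingsConnected S)
    (hring : ∀ v ∈ ringVertices S, IsRing (r v) (R v)) (h : FormGeneralizedPattern S r R) :
    ∃ q : ℝ, 0 < q ∧ q ≤ 1 ∧ ∀ v ∈ ringVertices S, Real.cosh (r v) = q * Real.cosh (R v) := by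
  obtain ⟨k, ℓ, h⟩ := h
  by_cases hne : (ringVertices S).Nonempty
  swap
  · exact ⟨1, one_pos, le_rfl, fun v hv => absurd ⟨v, hv⟩ hne⟩
  obtain ⟨b, hb⟩ := hne
  refine ⟨Real.cosh (r b) / Real.cosh (R b), div_pos (Real.cosh_pos _) (Real.cosh_pos _), ?_, ?_⟩
  · rw [div_le_one (Real.cosh_pos _), Real.cosh_le_cosh]
    obtain ⟨h1, h2, h3⟩ := hring b hb
    rw [abs_of_pos h1]
    exact abs_le.2 ⟨h2.le, h3⟩
  · intro v hv
    induction hG b hb v hv with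
    | refl => rw [div_mul_cancel₀ _ (Real.cosh_pos _).ne']
    | @tail x y _ hxy ih =>
      have h1 := ih hxy.symm.mem_right
      have h2 := h.cosh_mul_cosh hxy
      rw [h1] at h2
      apply mul_left_cancel₀ (Real.cosh_pos (R x)).ne'
      rw [h2]
      ring

lemma formGeneralizedPattern_iff (hS : IsSimplyConnected S) (hG : RingsConnected S)
    (hring : ∀ v ∈ ringVertices S, IsRing (r v) (R v)) :
    FormGeneralizedPattern S r R ↔ ∃ (q : ℝ) (γ : ℤ × ℤ → ℝ), 0 < q ∧ q ≤ 1 ∧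
      (∀ v ∈ ringVertices S, InInterval q (γ v) ∧ UniformizedByGamma q (γ v) (r v) (R v)) ∧
      ∀ v, IsInternal S v → GammaEquation q γ v := by
  have hR : ∀ v ∈ ringVertices S, 0 < R v := fun v hv => (hring v hv).1
  constructor
  · intro h
    obtain ⟨q, h0, h1, hq⟩ := h.exists_modulus hG hring
    have hγ := fun v hv => exists_uniformizedByGamma h0 h1 (hring v hv) (hq v hv)
    choose! γ hγ using hγ
    obtain ⟨k, ℓ, hp⟩ := h
    exact ⟨q, γ, h0, h1, hγ, fun v hv =>
      (gammaEquation_iff h0 h1 (fun v hv => (hγ v hv).2) hv).2 (hp.prod_cornerAngle hR hv)⟩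
  · rintro ⟨q, γ, h0, h1, hγ, heq⟩
    refine formGeneralizedPattern_of_prod_cornerAngle hS hR (fun v w hvw => ?_) fun v hv =>
      (gammaEquation_iff h0 h1 (fun v hv => (hγ v hv).2) hv).1 (heq v hv)
    rw [(hγ v hvw.symm.mem_right).2.cosh_inner_eq_mul h0,
      (hγ w hvw.mem_right).2.cosh_inner_eq_mul h0]
    ring

end Equations

end RingPattern

end

theorem mainTheorem5 (S : Set (ℤ × ℤ)) (hS : RingPattern.IsSimplyConnected S)
    (hG : RingPattern.RingsConnected S) (r R : ℤ × ℤ → ℝ)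
    (hring : ∀ v ∈ RingPattern.ringVertices S, RingPattern.IsRing (r v) (R v)) :
    (RingPattern.FormGeneralizedPattern S r R ↔
      ∃ (q : ℝ) (γ : ℤ × ℤ → ℝ), 0 < q ∧ q ≤ 1 ∧
        (∀ v ∈ RingPattern.ringVertices S, RingPattern.InInterval q (γ v) ∧
          RingPattern.UniformizedByBeta q (RingPattern.betaOf q (γ v)) (r v) (R v)) ∧
        ∀ v, RingPattern.IsInternal S v →
          RingPattern.BetaEquation q (fun w => RingPattern.betaOf q (γ w)) v) ∧
    (RingPattern.FormGeneralizedPattern S r R ↔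
      ∃ (q : ℝ) (γ : ℤ × ℤ → ℝ), 0 < q ∧ q ≤ 1 ∧
        (∀ v ∈ RingPattern.ringVertices S, RingPattern.InInterval q (γ v) ∧
          RingPattern.UniformizedByGamma q (γ v) (r v) (R v)) ∧
        ∀ v, RingPattern.IsInternal S v → RingPattern.GammaEquation q γ v) ∧
    (∀ (q : ℝ) (γ : ℤ × ℤ → ℝ), 0 < q → q ≤ 1 →
      (∀ v ∈ RingPattern.ringVertices S, RingPattern.InInterval q (γ v)) →
      ∀ v, RingPattern.IsInternal S v →
        (RingPattern.BetaEquation q (fun w => RingPattern.betaOf q (γ w)) v ↔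
          RingPattern.GammaEquation q γ v)) := by
  have h := RingPattern.formGeneralizedPattern_iff hS hG hring
  refine ⟨h.trans ?_, h, fun q γ h0 h1 _ v _ => RingPattern.betaEquation_iff h0 h1 γ v⟩
  constructor
  · rintro ⟨q, γ, h0, h1, h2, h3⟩
    exact ⟨q, γ, h0, h1,
      fun v hv => ⟨(h2 v hv).1, (RingPattern.uniformizedByBeta_iff h0 h1).2 (h2 v hv).2⟩,
      fun v hv => (RingPattern.betaEquation_iff h0 h1 γ v).2 (h3 v hv)⟩
  · rintro ⟨q, γ, h0, h1, h2, h3⟩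
    exact ⟨q, γ, h0, h1,
      fun v hv => ⟨(h2 v hv).1, (RingPattern.uniformizedByBeta_iff h0 h1).1 (h2 v hv).2⟩,
      fun v hv => (RingPattern.betaEquation_iff h0 h1 γ v).1 (h3 v hv)⟩
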